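/- **Theorem.** Let $2\le p\le\infty$ and let $\phi:\mathbb R\to(0,\infty)$ be a locally absolutely continuous function for which there are a function $v:\mathbb R\to[0,\infty)$ and constants $C_0,A>0$ such that 1. $v(x+y)\le v(x)\,v(y)$ and $\phi(x+y)\le C_0\,v(x)\,\phi(y)$ for all $x,y\in\mathbb R$; 2. $\inf_{x\in\mathbb R}v(x)>0$ and $v\,e^{-|\cdot|}\in L^p(\mathbb R)$; 3. $|\phi'(x)|\le A\,|\phi(x)|$ for a.e. $x\in\mathbb R$. Let $T>0$, $s>\frac52$, and let the real-valued function $u\in C([0,T],H^s(\mathbb R))$ be a strong solution on $[0,T]$ of the Cauchy problem $$u_t-u_{txx}=\partial_x(2+\partial_x)\big[(2-\partial_x)u\big]^2,\qquad u(0,x)=u_0(x),$$ that is, the derivative $u_t$ exists in $H^{s-1}(\mathbb R)$ for every $0<t<T$ and the equation holds in the sense of distributions in $x$ at every such $t$. (Each $u(t)$ is identified with its continuous, hence $C^2$, representative.) Assume that $$\partial_x^ju_0\,\phi\in L^p(\mathbb R)\quad\text{and}\quad \partial_x^ju_0\,\phi^{1/2}\in L^2(\mathbb R)\qquad\text{for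 } j=0,1,2.$$ Then $$\sup_{t\in[0,T]}\big(\|u(t)\phi\|_p+\|\partial_xu(t)\phi\|_p+\|\partial_x^2u(t)\phi\|_p\big)<\infty$$ and $$\sup_{t\in[0,T]}\big(\|u(t)\phi^{1/2}\|_2+\|\partial_xu(t)\phi^{1/2}\|_2+\|\partial_x^2u(t)\phi^{1/2}\|_2\big)<\infty .$$ Moreover, the weight $\phi(x)=e^{|x|}$, with $v(x)=e^{|x|}$ and $p=\infty$, satisfies all the conditions imposed on $\phi$, $v$ and $p$ above. -/

import Mathlib

noncomputable section

namespace GCH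

/-! ### Weights -/

/-- `v` is a sub-multiplicative weight: a non-negative function with `v (x + y) ≤ v x * v y`. -/
structure IsSubmultiplicativeWeight (v : ℝ → ℝ) : Prop where
  nonneg : ∀ x, 0 ≤ v x
  submul : ∀ x y, v (x + y) ≤ v x * v y

/-- The positive function `φ` is `v`-moderate: `φ (x + y) ≤ C₀ * v x * φ y` for some `C₀ > 0`. -/
structure IsModerate (v φ : ℝ → ℝ) : Prop where
  pos : ∀ x, 0 < φ x
  moderate : ∃ C₀ : ℝ, 0 < C₀ ∧ ∀ x y, φ (x + y) ≤ C₀ * v x * φ y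

/-- Local absolute continuity on `ℝ`: absolute continuity on every compact interval. -/
def LocallyAbsolutelyContinuous (φ : ℝ → ℝ) : Prop :=
  ∀ a b : ℝ, AbsolutelyContinuousOnInterval φ a b

/-- `φ` is a (fast-growing) `v`-moderate weight: it satisfies all the requirements on an admissible
weight, except that the integrability of `v e^{-|x|}` is replaced by `v e^{-|x|} ∈ L^p`. -/
structure IsFastGrowingWeight (p : ENNReal) (v φ : ℝ → ℝ) : Prop where
  locallyAbsolutelyContinuous : LocallyAbsolutelyContinuous φ
  weight : IsSubmultiplicativeWeight v
  moderate : IsModerate v φ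
  iInf_pos : 0 < ⨅ x, v x
  memLp : MeasureTheory.MemLp (fun x => v x * Real.exp (-|x|)) p
  deriv_le : ∃ A : ℝ, 0 < A ∧
    ∀ᵐ x ∂(MeasureTheory.volume : MeasureTheory.Measure ℝ), |deriv φ x| ≤ A * |φ x|

/-! ### Sobolev-space valued curves

The Bessel potential `⟨D⟩^r` is an isometric isomorphism of `H^r(ℝ)` onto `L²(ℝ)`, so continuity and
differentiability of a curve in `H^r(ℝ)` are continuity and differentiability in `L²(ℝ)` of its
image under `⟨D⟩^r`. -/

/-- Complex-valued `L²(ℝ)`. -/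
abbrev L2 : Type := MeasureTheory.Lp ℂ 2 (MeasureTheory.volume : MeasureTheory.Measure ℝ)

/-- `F ∈ H^r(ℝ)` and `⟨D⟩^r F` is the `L²` function `g`; thus `‖g‖` is the `H^r` norm of `F`. -/
def HasBesselPotential (r : ℝ) (F : TemperedDistribution ℝ ℂ) (g : L2) : Prop :=
  TemperedDistribution.besselPotential ℝ ℂ r F = MeasureTheory.Lp.toTemperedDistribution g

/-- `U ∈ C(S, H^r(ℝ))`. -/
def SobolevContinuousOn (r : ℝ) (U : ℝ → TemperedDistribution ℝ ℂ) (S : Set ℝ) : Prop :=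
  ∃ g : ℝ → L2, (∀ t ∈ S, HasBesselPotential r (U t) (g t)) ∧ ContinuousOn g S

/-- The curve `U` takes values in `H^r(ℝ)` near time `t`, and it is differentiable at `t` in the
norm of `H^r(ℝ)`, with derivative `V`. -/
def HasSobolevDerivAt (r : ℝ) (U : ℝ → TemperedDistribution ℝ ℂ) (V : TemperedDistribution ℝ ℂ)
    (t : ℝ) : Prop :=
  ∃ (g : ℝ → L2) (g' : L2), (∀ᶠ τ in nhds t, HasBesselPotential r (U τ) (g τ)) ∧
    HasBesselPotential r V g' ∧ HasDerivAt g g' t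

/-- The real function `f` is the continuous representative of the distribution `F ∈ L²(ℝ)`.
(An element of `H^s(ℝ)`, `s > 1 / 2`, has exactly one such representative, and it is `C²` if
`s > 5 / 2`, so that its derivatives up to order two are classical.) -/
def Represents (f : ℝ → ℝ) (F : TemperedDistribution ℝ ℂ) : Prop :=
  Continuous f ∧ ∃ hf : MeasureTheory.MemLp (fun x => (f x : ℂ)) 2 MeasureTheory.volume,
    F = MeasureTheory.Lp.toTemperedDistribution (hf.toLp : L2)

/-! ### The equation -/

/-- `w`, as the value at a fixed time of `u_t`, and the spatial profile `f`, as the value of `u`,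
satisfy `w - w_xx = ∂ₓ (2 + ∂ₓ) [(2 - ∂ₓ) f]²` in the sense of (tempered) distributions on `ℝ`. -/
def SatisfiesEquation (f : ℝ → ℝ) (w : TemperedDistribution ℝ ℂ) : Prop :=
  ∃ Q : L2, (Q =ᵐ[MeasureTheory.volume] fun x => (((2 * f x - deriv f x) ^ 2 : ℝ) : ℂ)) ∧
    w - TemperedDistribution.derivCLM ℂ (TemperedDistribution.derivCLM ℂ w) =
      TemperedDistribution.derivCLM ℂ ((2 : ℂ) • MeasureTheory.Lp.toTemperedDistribution Q +
        TemperedDistribution.derivCLM ℂ (MeasureTheory.Lp.toTemperedDistribution Q))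

/-- `u ∈ C([0,T], H^s(ℝ))` is a strong solution on `[0,T]` of the Cauchy problem
`u_t - u_txx = ∂ₓ (2 + ∂ₓ) [(2 - ∂ₓ) u]²`, `u(0,·) = u₀`: the time derivative `u_t` exists in
`H^{s-1}(ℝ)` for `0 < t < T` and the equation holds at each of these times. -/
def IsStrongSolution (s T : ℝ) (u₀ : ℝ → ℝ) (u : ℝ → ℝ → ℝ) : Prop :=
  u 0 = u₀ ∧ ∃ U : ℝ → TemperedDistribution ℝ ℂ,
    (∀ t ∈ Set.Icc 0 T, Represents (u t) (U t)) ∧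
    SobolevContinuousOn s U (Set.Icc 0 T) ∧
    ∀ t ∈ Set.Ioo 0 T, ∃ V : TemperedDistribution ℝ ℂ,
      HasSobolevDerivAt (s - 1) U V t ∧ SatisfiesEquation (u t) V

/-- `‖f φ‖_p + ‖f' φ‖_p + ‖f'' φ‖_p`. -/
def weightedNorm (p : ENNReal) (φ f : ℝ → ℝ) : ENNReal :=
  MeasureTheory.eLpNorm (fun x => f x * φ x) p MeasureTheory.volume +
    MeasureTheory.eLpNorm (fun x => deriv f x * φ x) p MeasureTheory.volume +
    MeasureTheory.eLpNorm (fun x => deriv (deriv f) x * φ x) p MeasureTheory.volume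

/-- `f φ`, `f' φ` and `f'' φ` belong to `L^p(ℝ)`. -/
def MemWeighted (p : ENNReal) (φ f : ℝ → ℝ) : Prop :=
  MeasureTheory.MemLp (fun x => f x * φ x) p MeasureTheory.volume ∧
    MeasureTheory.MemLp (fun x => deriv f x * φ x) p MeasureTheory.volume ∧
    MeasureTheory.MemLp (fun x => deriv (deriv f) x * φ x) p MeasureTheory.volume

end GCH

end

/-! Put w = 2u - u_x and G = e^{-|x|}/2, so that (1 - ∂ₓ²)G = δ. Applying (2 - ∂ₓ)(1 - ∂ₓ²)⁻¹ to the
equation and writing 4 - ∂ₓ² = 3 + (1 - ∂ₓ²) gives w_t = 2 w w_x + 3 ∂ₓG * w²: a Burgers equation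
whose source satisfies |∂ₓG * w²| ≤ G * w². Since s > 5/2, evaluation of u, u_x, u_xx is bounded on
H^s, and evaluation of u_t, u_tx is bounded on H^{s-1}; hence the equation holds classically, and
|w|, |w_x| ≤ M (`IsStrongSolution.exists_isReducedSolution`).

Along a characteristic q' = -2w(τ, q) the derivative of w is 3 ∂ₓG * w². Characteristics travel at
most 2MT and their flow is bi-Lipschitz. The bound on φ' makes log φ Lipschitz, so transport along
characteristics costs only constant factors in weighted L^p norms (`eLpNorm_mul_le_of_flow`). It
remains to control the weighted norm of G * w². The same applies to w_x, whose source is bounded by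
3(G * w² + w²) because ∂ₓ²G * w² = G * w² - w².

The function v e^{-|x|} lies only in L^p, so φ (G * w²) cannot be bounded by an L¹ kernel acting on
φ|w|. The estimate therefore has two stages. In L² with weight √φ the relevant kernel √v e^{-|x|} is
dominated by an integrable one, and a Gronwall argument, run on truncated weights so that all norms
are finite, bounds √φ w (`exists_eLpNorm_two_mul_le`). Then φ w² is bounded in L¹, and φ (G * w²) ≤
C (v e^{-|·|}) * (φ w²) is bounded in L^p by Young's inequality L^p * L¹
(`eLpNorm_mul_convGreen_sq_le'`), with no further Gronwall step.

Finally u = (2 - ∂ₓ)⁻¹ w is a one-sided convolution with e^{-2z}. This decay does leave an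
integrable kernel after the weight is moved inside, and u_x = 2u - w, u_xx = 2u_x - w_x give the
other two norms. -/

noncomputable section
namespace GCH
open MeasureTheory FourierTransform Real

/-! ### The Sobolev embedding -/

/-- The Fourier symbol of `∂ₓ^j ⟨D⟩^{-r}`. -/
def besselSymbol (r : ℝ) (j : ℕ) (ξ : ℝ) : ℂ :=
  (2 * π * Complex.I * ξ) ^ j * (((1 + ‖ξ‖ ^ 2) ^ (-r / 2) : ℝ) : ℂ)

lemma continuous_besselSymbol (r : ℝ) (j : ℕ) : Continuous (besselSymbol r j) := by
  unfold besselSymbol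
  have : Continuous fun ξ : ℝ => (1 + ‖ξ‖ ^ 2) ^ (-r / 2) :=
    Continuous.rpow_const (by fun_prop) fun x => Or.inl (by positivity)
  fun_prop

lemma besselSymbol_succ (r : ℝ) (j : ℕ) (ξ : ℝ) :
    besselSymbol r (j + 1) ξ = (2 * π * Complex.I * ξ) * besselSymbol r j ξ := by
  simp only [besselSymbol]; ring

/-- Since |ξ|^{2j} ≤ (1 + |ξ|²)^j, the squared symbol is at most a constant times (1 +
|ξ|²)^{-(r-j)}, which is integrable on the line because 2(r - j) > 1. -/
lemma memLp_besselSymbol {r : ℝ} {j : ℕ} (h : j + 1 / 2 < r) : MemLp (besselSymbol r j) 2 := by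
  rw [memLp_two_iff_integrable_sq_norm (continuous_besselSymbol r j).aestronglyMeasurable]
  have h1 : Integrable fun ξ : ℝ => (2 * π) ^ (2 * j) * (1 + ‖ξ‖ ^ 2) ^ (-(2 * r - 2 * j) / 2) :=
    (integrable_rpow_neg_one_add_norm_sq (by simp; linarith)).const_mul _
  refine h1.mono' ((continuous_besselSymbol r j).norm.pow 2).aestronglyMeasurable
    (Filter.Eventually.of_forall fun ξ => ?_)
  have hp : (0 : ℝ) < 1 + ‖ξ‖ ^ 2 := by positivity
  rw [Real.norm_of_nonneg (by positivity), besselSymbol, norm_mul, norm_pow, Complex.norm_real,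
    Real.norm_of_nonneg (by positivity : 0 ≤ (1 + ‖ξ‖ ^ 2) ^ (-r / 2))]
  have e1 : ‖(2 * π * Complex.I * ξ : ℂ)‖ = 2 * π * ‖ξ‖ := by
    simp [abs_of_pos Real.pi_pos]
  have e2 : (1 + ‖ξ‖ ^ 2) ^ (-(2 * r - 2 * j) / 2) =
      ((1 + ‖ξ‖ ^ 2) ^ (-r / 2)) ^ 2 * (1 + ‖ξ‖ ^ 2) ^ j := by
    rw [← Real.rpow_natCast (_ ^ (-r / 2)) 2, ← Real.rpow_natCast _ j, ← Real.rpow_mul hp.le,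
      ← Real.rpow_add hp]
    congr 1; push_cast; ring
  rw [e1, e2]
  have e3 : (‖ξ‖ ^ j) ^ 2 ≤ (1 + ‖ξ‖ ^ 2) ^ j := by
    rw [← pow_mul, mul_comm j 2, pow_mul]; gcongr; linarith
  have e4 : ((2 * π) ^ j) ^ 2 = (2 * π) ^ (2 * j) := by rw [← pow_mul, mul_comm j]
  calc ((2 * π * ‖ξ‖) ^ j * (1 + ‖ξ‖ ^ 2) ^ (-r / 2)) ^ 2
      = ((2 * π) ^ j) ^ 2 * (((1 + ‖ξ‖ ^ 2) ^ (-r / 2)) ^ 2 * (‖ξ‖ ^ j) ^ 2) := by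
        rw [mul_pow (2 * π) _ j]; ring
    _ ≤ (2 * π) ^ (2 * j) * (((1 + ‖ξ‖ ^ 2) ^ (-r / 2)) ^ 2 * (1 + ‖ξ‖ ^ 2) ^ j) := by
        rw [e4]; gcongr

/-- The `L²` function whose conjugate represents evaluation of `∂ₓ^j ⟨D⟩^{-r}` at `x`. -/
def besselKernel (r : ℝ) (j : ℕ) (x ξ : ℝ) : ℂ :=
  starRingEnd ℂ ((𝐞 (-(ξ * -x)) : ℂ) * besselSymbol r j ξ)

lemma norm_besselKernel (r : ℝ) (j : ℕ) (x ξ : ℝ) :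
    ‖besselKernel r j x ξ‖ = ‖besselSymbol r j ξ‖ := by
  rw [besselKernel, RCLike.norm_conj, norm_mul, Circle.norm_coe, one_mul]

lemma memLp_besselKernel {r : ℝ} {j : ℕ} (h : j + 1 / 2 < r) (x : ℝ) :
    MemLp (besselKernel r j x) 2 := by
  refine (memLp_besselSymbol h).of_le ?_ (Filter.Eventually.of_forall fun ξ =>
    (norm_besselKernel r j x ξ).le)
  have := continuous_besselSymbol r j
  unfold besselKernel
  exact Continuous.aestronglyMeasurable (by fun_prop)

open Classical in
/-- The functional `g ↦ ∂ₓ^j ⟨D⟩^{-r} g (x)` on `L²`. -/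
def besselEval (r : ℝ) (j : ℕ) (x : ℝ) : L2 →L[ℂ] ℂ :=
  if h : j + 1 / 2 < r then
    (innerSL ℂ ((memLp_besselKernel h x).toLp : L2)) ∘L fourierCLM ℂ L2
  else 0

lemma integrable_besselSymbol_mul {r : ℝ} {j : ℕ} (h : j + 1 / 2 < r) (g : L2) :
    Integrable fun ξ => besselSymbol r j ξ * g ξ :=
  (memLp_besselSymbol h).integrable_mul (Lp.memLp g)

lemma besselEval_apply {r : ℝ} {j : ℕ} (h : j + 1 / 2 < r) (x : ℝ) (g : L2) :
    besselEval r j x g = 𝓕 (fun ξ => besselSymbol r j ξ * (𝓕 g : L2) ξ) (-x) := by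
  rw [besselEval, dif_pos h]
  simp only [ContinuousLinearMap.comp_apply, innerSL_apply_apply, fourierCLM_apply]
  rw [L2.inner_def, Real.fourier_real_eq]
  refine integral_congr_ae ?_
  filter_upwards [(memLp_besselKernel h x).coeFn_toLp] with ξ hξ
  rw [hξ]
  simp [besselKernel, Circle.smul_def]
  ring

/-- The kernels for different x differ by a phase, so the bound is uniform in x. It turns continuity
and differentiability of a curve in H^r into pointwise statements. -/
lemma norm_besselEval_le {r : ℝ} {j : ℕ} (h : j + 1 / 2 < r) (x : ℝ) :
    ‖besselEval r j x‖ ≤ (eLpNorm (besselSymbol r j) 2 volume).toReal := by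
  refine ContinuousLinearMap.opNorm_le_bound _ ENNReal.toReal_nonneg fun g => ?_
  rw [besselEval, dif_pos h]
  simp only [ContinuousLinearMap.comp_apply, innerSL_apply_apply, fourierCLM_apply]
  refine (norm_inner_le_norm _ _).trans ?_
  rw [Lp.norm_fourier_eq, Lp.norm_toLp]
  rw [eLpNorm_congr_norm_ae (Filter.Eventually.of_forall (norm_besselKernel r j x))]

lemma hasDerivAt_besselEval {r : ℝ} {j : ℕ} (h : j + 1 + 1 / 2 < r) (g : L2) (x : ℝ) :
    HasDerivAt (fun x => besselEval r j x g) (besselEval r (j + 1) x g) x := by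
  have h0 : (j : ℝ) + 1 / 2 < r := by linarith
  have h1 : ((j + 1 : ℕ) : ℝ) + 1 / 2 < r := by push_cast; linarith
  simp only [besselEval_apply h0, besselEval_apply h1]
  have i0 := integrable_besselSymbol_mul h0 (𝓕 g)
  have i1 : Integrable fun ξ : ℝ => ξ • (besselSymbol r j ξ * (𝓕 g : L2) ξ) := by
    have := (integrable_besselSymbol_mul h1 (𝓕 g)).const_mul (2 * π * Complex.I)⁻¹
    refine this.congr (Filter.Eventually.of_forall fun ξ => ?_)
    have hpi : (π : ℂ) ≠ 0 := by exact_mod_cast Real.pi_ne_zero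
    simp only [besselSymbol_succ, Complex.real_smul]
    field_simp
  have := (Real.hasDerivAt_fourier i0 i1 (-x)).scomp x (hasDerivAt_neg x)
  refine this.congr_deriv ?_
  rw [neg_smul, one_smul, Real.fourier_real_eq, Real.fourier_real_eq, ← integral_neg]
  congr 1
  ext ξ
  rw [← smul_neg, besselSymbol_succ]
  congr 1
  rw [smul_eq_mul]; ring

lemma continuous_besselEval {r : ℝ} {j : ℕ} (h : j + 1 / 2 < r) (g : L2) :
    Continuous fun x => besselEval r j x g := by
  simp only [besselEval_apply h]
  have i0 := integrable_besselSymbol_mul h (𝓕 g)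
  have : Continuous (𝓕 (fun ξ => besselSymbol r j ξ * (𝓕 g : L2) ξ)) :=
    VectorFourier.fourierIntegral_continuous Real.continuous_fourierChar
      (by exact continuous_inner) i0
  exact this.comp continuous_neg

/-- Move the Fourier transform onto the test function, where `F` becomes multiplication by the
symbol times 𝓕g, and return with the multiplication formula ∫ 𝓕ψ · H = ∫ ψ · 𝓕H; the symbol times 𝓕g
is integrable because r > 1/2. -/
lemma HasBesselPotential.apply_eq_integral {r : ℝ} (h : 1 / 2 < r)
    {F : TemperedDistribution ℝ ℂ} {g : L2} (hF : HasBesselPotential r F g)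
    (ψ : SchwartzMap ℝ ℂ) : F ψ = ∫ x, ψ x * besselEval r 0 x g := by
  have h0 : ((0 : ℕ) : ℝ) + 1 / 2 < r := by simpa using h
  have hF' := (TemperedDistribution.besselPotential_neg_apply_eq_iff r _ F).2 hF
  have e1 : F ψ = (𝓕 F) (𝓕⁻ ψ) := by simp
  rw [e1, ← hF', TemperedDistribution.fourier_besselPotential_eq_smulLeftCLM_fourier_apply,
    Lp.fourier_toTemperedDistribution_eq, TemperedDistribution.smulLeftCLM_apply_apply,
    Lp.toTemperedDistribution_apply]
  have i0 := integrable_besselSymbol_mul h0 (𝓕 g)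
  set H : ℝ → ℂ := fun ξ => besselSymbol r 0 ξ * (𝓕 g : L2) ξ with hH
  have e2 : ∀ ξ : ℝ, (SchwartzMap.smulLeftCLM ℂ
      (fun x : ℝ => (((1 + ‖x‖ ^ 2) ^ (-r / 2) : ℝ) : ℂ)) (𝓕⁻ ψ)) ξ • (𝓕 g : L2) ξ
      = 𝓕 (ψ : ℝ → ℂ) (-ξ) • H ξ := by
    intro ξ
    rw [SchwartzMap.smulLeftCLM_apply_apply (by fun_prop), SchwartzMap.fourierInv_coe,
      Real.fourierInv_eq_fourier_neg, hH]
    simp [besselSymbol]; ring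
  simp_rw [e2]
  have e3 : ∫ ξ, 𝓕 (ψ : ℝ → ℂ) (-ξ) • H ξ = ∫ ξ, 𝓕 (ψ : ℝ → ℂ) ξ • H (-ξ) := by
    rw [← integral_neg_eq_self]; simp
  have e4 : ∫ ξ, 𝓕 (ψ : ℝ → ℂ) ξ • H (-ξ) = ∫ x, ψ x • 𝓕 (fun ξ => H (-ξ)) x := by
    have := VectorFourier.integral_fourierIntegral_smul_eq_flip (L := innerₗ ℝ) (μ := volume)
      (ν := volume) Real.continuous_fourierChar (by exact continuous_inner) ψ.integrable i0.comp_neg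
    rw [flip_innerₗ] at this
    exact this
  rw [e3, e4]
  refine integral_congr_ae (Filter.Eventually.of_forall fun x => ?_)
  simp only [besselEval_apply h0, smul_eq_mul]
  congr 1
  rw [Real.fourier_real_eq, Real.fourier_real_eq, ← integral_neg_eq_self]
  simp [hH]

end GCH
end

noncomputable section
namespace GCH
open MeasureTheory Set Filter Topology

/-! ### From distributional to classical derivatives -/

lemma integrable_mul_of_hasCompactSupport {ψ g : ℝ → ℂ} (hψ : Continuous ψ)
    (hs : HasCompactSupport ψ) (hg : Continuous g) : Integrable fun x => ψ x * g x :=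
  (hψ.mul hg).integrable_of_hasCompactSupport hs.mul_right

lemma integral_deriv_mul_eq_neg {ψ ψ' g g' : ℝ → ℂ} (hψ : ∀ x, HasDerivAt ψ (ψ' x) x)
    (hψc : Continuous ψ') (hs : HasCompactSupport ψ) (hs' : HasCompactSupport ψ')
    (hg : ∀ x, HasDerivAt g (g' x) x) (hgc : Continuous g') :
    ∫ x, ψ' x * g x = -∫ x, ψ x * g' x := by
  have c1 : Continuous ψ := continuous_iff_continuousAt.2 fun x => (hψ x).continuousAt
  have c2 : Continuous g := continuous_iff_continuousAt.2 fun x => (hg x).continuousAt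
  have := integral_mul_deriv_eq_deriv_mul_of_integrable (u := ψ) (v := g)
    (fun x _ => hψ x) (fun x _ => hg x) (integrable_mul_of_hasCompactSupport c1 hs hgc)
    (integrable_mul_of_hasCompactSupport hψc hs' c2) (integrable_mul_of_hasCompactSupport c1 hs c2)
  rw [this, neg_neg]

/-- A continuous function all of whose pairings with derivatives of test functions vanish is
constant. -/
lemma eq_of_integral_deriv_smul_eq_zero {R : ℝ → ℂ} (hR : Continuous R)
    (h : ∀ ψ : ℝ → ℝ, ContDiff ℝ (⊤ : ℕ∞) ψ → HasCompactSupport ψ → ∫ x, deriv ψ x • R x = 0)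
    (x y : ℝ) : R x = R y := by
  let φ : ℕ → ContDiffBump (0 : ℝ) := fun n =>
    ⟨1 / (n + 1) / 2, 1 / (n + 1), by positivity, half_lt_self (by positivity)⟩
  have hφ : Tendsto (fun n => (φ n).rOut) atTop (𝓝 0) := tendsto_one_div_add_atTop_nhds_zero_nat
  set c : ℕ → ℝ → ℂ := fun n =>
    convolution ((φ n).normed volume) R (ContinuousLinearMap.lsmul ℝ ℝ) volume with hc
  -- The derivative of the mollification at z pairs R with a derivative of the bump reflected about
  -- z, up to sign, and so vanishes. Each mollification is constant, and they converge pointwise to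
  -- R.
  have hd : ∀ n z, HasDerivAt (c n) 0 z := by
    intro n z
    have h1 := HasCompactSupport.hasDerivAt_convolution_left (ContinuousLinearMap.lsmul ℝ ℝ)
      (μ := volume) (f₀ := (φ n).normed volume) (g₀ := R) (φ n).hasCompactSupport_normed
      ((φ n).contDiff_normed) hR.locallyIntegrable z
    refine h1.congr_deriv ?_
    set η : ℝ → ℝ := (φ n).normed volume with hη
    have hη1 : ContDiff ℝ (⊤ : ℕ∞) η := (φ n).contDiff_normed
    have hηd : Differentiable ℝ η := hη1.differentiable (by simp)
    have h2 := h (fun x => η (z - x)) (by fun_prop)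
      ((φ n).hasCompactSupport_normed.comp_homeomorph (Homeomorph.subLeft z))
    have h3 : ∀ x, deriv (fun x => η (z - x)) x = - deriv η (z - x) := by
      intro x
      exact ((hηd (z - x)).hasDerivAt.comp_const_sub z x).deriv
    rw [convolution_def]
    simp only [h3, neg_smul, integral_neg, neg_eq_zero] at h2
    rw [← h2, ← integral_sub_left_eq_self _ volume z]
    simp
  have he : ∀ n, c n x = c n y := fun n =>
    is_const_of_deriv_eq_zero (fun z => (hd n z).differentiableAt) (fun z => (hd n z).deriv) x y
  have t1 := ContDiffBump.convolution_tendsto_right_of_continuous (μ := volume) hφ hR x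
  have t2 := ContDiffBump.convolution_tendsto_right_of_continuous (μ := volume) hφ hR y
  refine tendsto_nhds_unique t1 (t2.congr fun n => (he n).symm)

/-- If a continuous function has a continuous distributional derivative, then it is
differentiable. -/
lemma hasDerivAt_of_integral_deriv_smul {Z V : ℝ → ℂ} (hZ : Continuous Z) (hV : Continuous V)
    (h : ∀ ψ : ℝ → ℝ, ContDiff ℝ (⊤ : ℕ∞) ψ → HasCompactSupport ψ →
      ∫ x, deriv ψ x • Z x = -∫ x, ψ x • V x) (x : ℝ) : HasDerivAt Z (V x) x := by
  obtain ⟨P, hPd⟩ : ∃ P : ℝ → ℂ, ∀ x, HasDerivAt P (V x) x :=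
    ⟨fun x => ∫ t in (0 : ℝ)..x, V t, fun x => (hV.integral_hasStrictDerivAt 0 x).hasDerivAt⟩
  have hPc : Continuous P := continuous_iff_continuousAt.2 fun x => (hPd x).continuousAt
  -- Z and a primitive P of V have the same distributional derivative, so Z - P is constant.
  have hR : ∀ x y, Z x - P x = Z y - P y := by
    refine eq_of_integral_deriv_smul_eq_zero (R := fun x => Z x - P x) (hZ.sub hPc)
      fun ψ h1 h2 => ?_
    have d1 : Differentiable ℝ ψ := h1.differentiable (by simp)
    have c1 : Continuous (deriv ψ) := h1.continuous_deriv (by simp)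
    have s1 : HasCompactSupport fun x => (ψ x : ℂ) :=
      h2.comp_left (g := fun x : ℝ => (x : ℂ)) Complex.ofReal_zero
    have s2 : HasCompactSupport fun x => ((deriv ψ x : ℝ) : ℂ) :=
      h2.deriv.comp_left (g := fun x : ℝ => (x : ℂ)) Complex.ofReal_zero
    have c1' : Continuous fun x => ((deriv ψ x : ℝ) : ℂ) := by fun_prop
    have e1 := integral_deriv_mul_eq_neg (ψ := fun x => (ψ x : ℂ)) (ψ' := fun x => ((deriv ψ x : ℝ) : ℂ))
      (fun x => (d1 x).hasDerivAt.ofReal_comp) c1' s1 s2 hPd hV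
    have e2 := h ψ h1 h2
    simp only [Complex.real_smul, mul_sub] at e2 ⊢
    rw [integral_sub (integrable_mul_of_hasCompactSupport c1' s2 hZ)
      (integrable_mul_of_hasCompactSupport c1' s2 hPc), e1, e2, sub_self]
  have hZP : Z = fun x => P x + (Z 0 - P 0) := by
    funext x
    rw [← hR x 0]; ring
  rw [hZP]
  exact (hPd x).add_const _

/-- Weakly, V - V'' = 2q' + q''. Grouping this as (V' + q' + 2q)' = V uses only first derivatives of
V and q, and both sides are continuous, so V' + q' + 2q is classically differentiable although V'
and q' separately need not be. -/
lemma SatisfiesEquation.hasDerivAt {f : ℝ → ℝ} {W : TemperedDistribution ℝ ℂ}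
    (h : SatisfiesEquation f W) {V V' : ℝ → ℂ} {q q' : ℝ → ℝ}
    (hW : ∀ ψ, W ψ = ∫ x, ψ x * V x) (hV : ∀ x, HasDerivAt V (V' x) x) (hVc : Continuous V')
    (hq : ∀ x, q x = (2 * f x - deriv f x) ^ 2) (hqd : ∀ x, HasDerivAt q (q' x) x)
    (hqc : Continuous q') (x : ℝ) :
    HasDerivAt (fun x => V' x + q' x + 2 * q x) (V x) x := by
  obtain ⟨Q, hQ, heq⟩ := h
  have cV : Continuous V := continuous_iff_continuousAt.2 fun x => (hV x).continuousAt
  have cq : Continuous q := continuous_iff_continuousAt.2 fun x => (hqd x).continuousAt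
  refine hasDerivAt_of_integral_deriv_smul (by fun_prop) cV (fun ψ h1 h2 => ?_) x
  have s0 : HasCompactSupport fun x => (ψ x : ℂ) :=
    h2.comp_left (g := fun x : ℝ => (x : ℂ)) Complex.ofReal_zero
  have k0 : ContDiff ℝ (⊤ : ℕ∞) fun x => (ψ x : ℂ) := Complex.ofRealCLM.contDiff.comp h1
  set Ψ : SchwartzMap ℝ ℂ := s0.toSchwartzMap k0 with hΨ
  have e0 : ∀ x, Ψ x = ψ x := fun x => rfl
  have k1 : ContDiff ℝ (⊤ : ℕ∞) (deriv ψ) := by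
    have : ContDiff ℝ ((⊤ : ℕ∞) + 1) ψ := h1.of_le (by simp)
    exact (contDiff_succ_iff_deriv.1 this).2.2
  have d0 : Differentiable ℝ ψ := h1.differentiable (by simp)
  have d1 : Differentiable ℝ (deriv ψ) := k1.differentiable (by simp)
  have e1 : ∀ x, SchwartzMap.derivCLM ℂ ℂ Ψ x = ((deriv ψ x : ℝ) : ℂ) := fun x => by
    rw [SchwartzMap.derivCLM_apply]
    exact (d0 x).hasDerivAt.ofReal_comp.deriv
  have e2 : ∀ x, SchwartzMap.derivCLM ℂ ℂ (SchwartzMap.derivCLM ℂ ℂ Ψ) x =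
      ((deriv (deriv ψ) x : ℝ) : ℂ) :=
    fun x => by
    rw [SchwartzMap.derivCLM_apply, (funext e1 : ⇑(SchwartzMap.derivCLM ℂ ℂ Ψ) = _)]
    exact (d1 x).hasDerivAt.ofReal_comp.deriv
  have c0 : Continuous fun x => (ψ x : ℂ) := k0.continuous
  have c1 : Continuous fun x => ((deriv ψ x : ℝ) : ℂ) := by
    have := d1.continuous; fun_prop
  have c2 : Continuous fun x => ((deriv (deriv ψ) x : ℝ) : ℂ) := by
    have := k1.continuous_deriv (by simp); fun_prop
  have s1 : HasCompactSupport fun x => ((deriv ψ x : ℝ) : ℂ) :=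
    h2.deriv.comp_left (g := fun x : ℝ => (x : ℂ)) Complex.ofReal_zero
  have s2 : HasCompactSupport fun x => ((deriv (deriv ψ) x : ℝ) : ℂ) :=
    h2.deriv.deriv.comp_left (g := fun x : ℝ => (x : ℂ)) Complex.ofReal_zero
  have hQ' : ∀ g : ℝ → ℂ, ∫ x, g x * Q x = ∫ x, g x * q x := fun g =>
    integral_congr_ae (by filter_upwards [hQ] with x hx; rw [hx, hq])
  have key := congrArg (fun D => D Ψ) heq
  simp only [_root_.sub_apply, _root_.add_apply,
    TemperedDistribution.derivCLM_apply_apply, map_neg,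
    _root_.smul_apply, _root_.neg_apply, neg_mul, integral_neg, neg_neg, hW,
    Lp.toTemperedDistribution_apply, e0, e1, e2,
    smul_eq_mul, hQ'] at key
  have b1 := integral_deriv_mul_eq_neg (fun x => (d1 x).hasDerivAt.ofReal_comp) c2 s1 s2 hV hVc
  have b2 := integral_deriv_mul_eq_neg (fun x => (d1 x).hasDerivAt.ofReal_comp) c2 s1 s2
    (g := fun x => (q x : ℂ)) (g' := fun x => (q' x : ℂ)) (fun x => (hqd x).ofReal_comp)
    (by fun_prop)
  rw [b1, b2] at key
  simp only [Complex.real_smul]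
  have i1 := integrable_mul_of_hasCompactSupport c1 s1 hVc
  have i2 := integrable_mul_of_hasCompactSupport c1 s1 (g := fun x => (q' x : ℂ)) (by fun_prop)
  have i3 := integrable_mul_of_hasCompactSupport c1 s1 (g := fun x => (q x : ℂ)) (by fun_prop)
  have b3 : ∫ x, ((deriv ψ x : ℝ) : ℂ) * (V' x + q' x + 2 * q x) =
      (∫ x, ((deriv ψ x : ℝ) : ℂ) * V' x) + (∫ x, ((deriv ψ x : ℝ) : ℂ) * q' x) +
      2 * ∫ x, ((deriv ψ x : ℝ) : ℂ) * q x := by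
    rw [← integral_const_mul, ← integral_add i1 i2, ← integral_add (by exact i1.add i2)
      (i3.const_mul 2)]
    congr 1; ext x; ring
  rw [b3]
  linear_combination key

/-! ### Bounded solutions of first order equations -/

/-- The bounded solution of `P' = c P - f`. -/
def halfLineIntegral (c : ℝ) (f : ℝ → ℝ) (x : ℝ) : ℝ :=
  ∫ z in Ioi (0 : ℝ), Real.exp (-c * z) * f (x + z)

lemma integrableOn_exp_mul_of_bounded {c M : ℝ} (hc : 0 < c) {f : ℝ → ℝ} (hf : Continuous f)
    (hM : ∀ x, |f x| ≤ M) : IntegrableOn (fun z => Real.exp (-c * z) * f z) (Ioi 0) := by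
  refine (exp_neg_integrableOn_Ioi 0 hc).mul_bdd (c := M) hf.aestronglyMeasurable
    (Eventually.of_forall fun x => ?_)
  exact hM _

/-- The derivative of -e^{-cz} P(x + z) in z is e^{-cz} f(x + z). Integrating over z > 0,
boundedness of P removes the contribution at infinity. -/
lemma eq_halfLineIntegral {c M K : ℝ} (hc : 0 < c) {P f : ℝ → ℝ} (hf : Continuous f)
    (hM : ∀ x, |f x| ≤ M) (hK : ∀ x, |P x| ≤ K) (hP : ∀ x, HasDerivAt P (c * P x - f x) x) (x : ℝ) :
    P x = halfLineIntegral c f x := by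
  have hd : ∀ z, HasDerivAt (fun z => -(Real.exp (-c * z) * P (x + z)))
      (Real.exp (-c * z) * f (x + z)) z := by
    intro z
    have h1 : HasDerivAt (fun z => Real.exp (-c * z)) (Real.exp (-c * z) * -c) z := by
      have := ((hasDerivAt_id z).const_mul (-c)).exp
      simpa using this
    have h2 : HasDerivAt (fun z => P (x + z)) (c * P (x + z) - f (x + z)) z :=
      (hP (x + z)).comp_const_add x z
    refine (h1.mul h2).neg.congr_deriv ?_
    ring
  have ht : Tendsto (fun z => -(Real.exp (-c * z) * P (x + z))) atTop (𝓝 0) := by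
    have h1 : Tendsto (fun z => K * Real.exp (-c * z)) atTop (𝓝 0) := by
      have : Tendsto (fun z : ℝ => -c * z) atTop atBot :=
        tendsto_id.const_mul_atTop_of_neg (by linarith)
      simpa using (Real.tendsto_exp_atBot.comp this).const_mul K
    refine squeeze_zero_norm (fun z => ?_) h1
    rw [norm_neg, norm_mul, Real.norm_of_nonneg (Real.exp_pos _).le, mul_comm]
    exact mul_le_mul_of_nonneg_right (hK _) (Real.exp_pos _).le
  have := integral_Ioi_of_hasDerivAt_of_tendsto (a := 0)
    (hd 0).continuousAt.continuousWithinAt (fun z _ => hd z)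
    (integrableOn_exp_mul_of_bounded hc (f := fun z => f (x + z)) (by fun_prop) fun z => hM _) ht
  rw [halfLineIntegral, this]
  simp

end GCH
end

/-! ### Nonlocal Burgers form of the equation -/

noncomputable section
namespace GCH
open MeasureTheory Set Filter Topology

/-- `∂ₓ G * q`, where `G = e^{-|x|} / 2`. -/
def convGreenDeriv (q : ℝ → ℝ) (x : ℝ) : ℝ :=
  (halfLineIntegral 1 q x - halfLineIntegral 1 (fun y => q (-y)) (-x)) / 2

/-- `G * q`, where `G = e^{-|x|} / 2`. -/
def convGreen (q : ℝ → ℝ) (x : ℝ) : ℝ :=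
  (halfLineIntegral 1 q x + halfLineIntegral 1 (fun y => q (-y)) (-x)) / 2

lemma halfLineIntegral_const_mul (c k : ℝ) (f : ℝ → ℝ) (x : ℝ) :
    halfLineIntegral c (fun y => k * f y) x = k * halfLineIntegral c f x := by
  rw [halfLineIntegral, halfLineIntegral, ← integral_const_mul]
  congr 1; ext z; ring

/-- The classical form of the equation, solved for the time derivative. -/
lemma SatisfiesEquation.eq_convGreenDeriv {f : ℝ → ℝ} {W : TemperedDistribution ℝ ℂ}
    (h : SatisfiesEquation f W) {V V' : ℝ → ℂ} {q q' : ℝ → ℝ} {K : ℝ}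
    (hW : ∀ ψ, W ψ = ∫ x, ψ x * V x) (hV : ∀ x, HasDerivAt V (V' x) x) (hVc : Continuous V')
    (hq : ∀ x, q x = (2 * f x - deriv f x) ^ 2) (hqd : ∀ x, HasDerivAt q (q' x) x)
    (hqc : Continuous q') (bV : ∀ x, ‖V x‖ ≤ K) (bV' : ∀ x, ‖V' x‖ ≤ K)
    (bq : ∀ x, |q x| ≤ K) (bq' : ∀ x, |q' x| ≤ K) :
    (∀ x, 2 * (V x).re - (V' x).re = q' x + 3 * convGreenDeriv q x) ∧
    ∀ x, HasDerivAt (convGreenDeriv q) (convGreen q x - q x) x := by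
  have cq : Continuous q := continuous_iff_continuousAt.2 fun x => (hqd x).continuousAt
  have re_deriv : ∀ {G G' : ℝ → ℂ}, (∀ x, HasDerivAt G (G' x) x) →
      ∀ x, HasDerivAt (fun x => (G x).re) (G' x).re x := fun hG x =>
    (Complex.reCLM.hasFDerivAt.comp_hasDerivAt x (hG x) :)
  set v : ℝ → ℝ := fun x => (V x).re with hv
  set v' : ℝ → ℝ := fun x => (V' x).re with hv'
  have bv : ∀ x, |v x| ≤ K := fun x => (Complex.abs_re_le_norm _).trans (bV x)
  have bv' : ∀ x, |v' x| ≤ K := fun x => (Complex.abs_re_le_norm _).trans (bV' x)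
  have dv : ∀ x, HasDerivAt v (v' x) x := re_deriv hV
  have dZ : ∀ x, HasDerivAt (fun x => v' x + q' x + 2 * q x) (v x) x := by
    intro x
    have := re_deriv (h.hasDerivAt hW hV hVc hq hqd hqc) x
    simpa using this
  have dY : ∀ x, HasDerivAt (fun x => v x + q x) (v' x + q' x) x := fun x => (dv x).add (hqd x)
  -- With Y = v + q and Z = v' + q' + 2q one has Y' = v' + q' and Z' = v. The second-order equation
  -- thus splits into (Y + Z)' = (Y + Z) - 3q and (Y - Z)' = -(Y - Z) - q, whose bounded solutions
  -- are one-sided integrals; the second is brought to the form of the first by reflection.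
  have hP : ∀ x, v x + q x + (v' x + q' x + 2 * q x) = 3 * halfLineIntegral 1 q x := by
    intro x
    rw [← halfLineIntegral_const_mul]
    refine eq_halfLineIntegral (M := 3 * K) (K := 6 * K) one_pos (by fun_prop) (fun x => ?_)
      (fun x => ?_) (fun x => ?_) x
      (P := fun x => v x + q x + (v' x + q' x + 2 * q x))
    · rw [abs_mul, abs_of_pos (by norm_num : (0 : ℝ) < 3)]; linarith [bq x]
    · have := abs_le.1 (bv x); have := abs_le.1 (bv' x); have := abs_le.1 (bq x)
      have := abs_le.1 (bq' x)
      rw [abs_le]; constructor <;> linarith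
    · exact ((dY x).add (dZ x)).congr_deriv (by ring)
  have hN : ∀ x, v x + q x - (v' x + q' x + 2 * q x) =
      -halfLineIntegral 1 (fun y => q (-y)) (-x) := by
    intro x
    have e : -halfLineIntegral 1 (fun y => q (-y)) (-x) =
        halfLineIntegral 1 (fun y => -1 * q (-y)) (-x) := by
      rw [halfLineIntegral_const_mul 1 (-1) (fun y => q (-y))]; ring
    rw [e]
    have := eq_halfLineIntegral (M := K) (K := 6 * K) one_pos (f := fun y => -1 * q (-y))
      (by fun_prop) (fun x => ?_) (fun x => ?_) (fun x => ?_) (-x)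
      (P := fun y => v (-y) + q (-y) - (v' (-y) + q' (-y) + 2 * q (-y)))
    · simpa using this
    · simpa using bq (-x)
    · have := abs_le.1 (bv (-x)); have := abs_le.1 (bv' (-x)); have := abs_le.1 (bq (-x))
      have := abs_le.1 (bq' (-x))
      rw [abs_le]; constructor <;> linarith
    · exact (((dY (-x)).sub (dZ (-x))).comp x (hasDerivAt_neg x)).congr_deriv (by ring)
  have e2 : ∀ x, 2 * v x - v' x = q' x + 3 * convGreenDeriv q x := by
    intro x
    rw [convGreenDeriv]
    linear_combination (1 / 2) * hP x + (3 / 2) * hN x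
  refine ⟨e2, fun x => ?_⟩
  -- The nonlocal term is (Y + Z)/6 + (Y - Z)/2, whose derivative is already known.
  have e3 : convGreenDeriv q = fun x => ((v x + q x + (v' x + q' x + 2 * q x)) / 3 +
      (v x + q x - (v' x + q' x + 2 * q x))) / 2 := by
    funext x
    rw [hP, hN, convGreenDeriv]; ring
  rw [e3]
  refine ((((dY x).add (dZ x)).div_const 3).add ((dY x).sub (dZ x))).div_const 2 |>.congr_deriv ?_
  rw [convGreen]
  linear_combination (1 / 6) * hP x - (1 / 2) * hN x

/-- The equation in terms of `w = 2 u - u_x`: a Burgers equation with a nonlocal source. -/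
structure IsReducedSolution (T M : ℝ) (w wx : ℝ → ℝ → ℝ) : Prop where
  pos : 0 < T
  cont : Continuous fun z : ℝ × ℝ => w z.1 z.2
  cont_x : Continuous fun z : ℝ × ℝ => wx z.1 z.2
  bound : ∀ t x, |w t x| ≤ M
  bound_x : ∀ t x, |wx t x| ≤ M
  hasDerivAt_x : ∀ t x, HasDerivAt (w t) (wx t x) x
  hasDerivAt_t : ∀ t ∈ Ioo 0 T, ∀ x, HasDerivAt (fun τ => w τ x)
    (2 * w t x * wx t x + 3 * convGreenDeriv (fun y => w t y ^ 2) x) t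
  hasDerivAt_convGreenDeriv : ∀ t ∈ Ioo 0 T, ∀ x,
    HasDerivAt (convGreenDeriv fun y => w t y ^ 2)
      (convGreen (fun y => w t y ^ 2) x - w t x ^ 2) x

lemma continuous_halfLineIntegral {X : Type*} [TopologicalSpace X] [FirstCountableTopology X]
    {c M : ℝ} (hc : 0 < c) {f : X → ℝ → ℝ} {a : X → ℝ} (ha : Continuous a)
    (hf : Continuous fun z : X × ℝ => f z.1 z.2) (hM : ∀ t x, |f t x| ≤ M) :
    Continuous fun t => halfLineIntegral c (f t) (a t) := by
  have hf' : Continuous fun z : X × ℝ => f z.1 (a z.1 + z.2) :=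
    hf.comp (f := fun z : X × ℝ => (z.1, a z.1 + z.2)) (by fun_prop)
  refine continuous_of_dominated (bound := fun z => Real.exp (-c * z) * M) (fun t => ?_)
    (fun t => Eventually.of_forall fun z => ?_)
    ((exp_neg_integrableOn_Ioi 0 hc).mul_const M)
    (Eventually.of_forall fun z => ?_)
  · have : Continuous fun z : ℝ => f t (a t + z) :=
      hf'.comp (f := fun z : ℝ => (t, z)) (by fun_prop)
    exact Continuous.aestronglyMeasurable (by fun_prop)
  · rw [norm_mul, Real.norm_of_nonneg (Real.exp_pos _).le]
    exact mul_le_mul_of_nonneg_left (hM _ _) (Real.exp_pos _).le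
  · have : Continuous fun t : X => f t (a t + z) :=
      hf'.comp (f := fun t : X => (t, z)) (by fun_prop)
    exact continuous_const.mul this

namespace IsReducedSolution
variable {T M : ℝ} {w wx : ℝ → ℝ → ℝ}

lemma bound_nonneg (h : IsReducedSolution T M w wx) : 0 ≤ M :=
  (abs_nonneg _).trans (h.bound 0 0)

lemma sq_le (h : IsReducedSolution T M w wx) (t x : ℝ) : |w t x ^ 2| ≤ M ^ 2 := by
  rw [abs_pow]; exact pow_le_pow_left₀ (abs_nonneg _) (h.bound t x) 2

lemma continuous_left (h : IsReducedSolution T M w wx) :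
    Continuous fun z : ℝ × ℝ => halfLineIntegral 1 (fun y => w z.1 (-y) ^ 2) (-z.2) := by
  have := h.cont
  refine continuous_halfLineIntegral (M := M ^ 2) one_pos (f := fun (z : ℝ × ℝ) y => w z.1 (-y) ^ 2)
    (a := fun z => -z.2) (by fun_prop) ?_ fun z y => h.sq_le _ _
  exact (this.comp (f := fun z : (ℝ × ℝ) × ℝ => (z.1.1, -z.2)) (by fun_prop)).pow 2

lemma continuous_right (h : IsReducedSolution T M w wx) :
    Continuous fun z : ℝ × ℝ => halfLineIntegral 1 (fun y => w z.1 y ^ 2) z.2 := by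
  have := h.cont
  refine continuous_halfLineIntegral (M := M ^ 2) one_pos (f := fun (z : ℝ × ℝ) y => w z.1 y ^ 2)
    (a := fun z => z.2) (by fun_prop) ?_ fun z y => h.sq_le _ _
  exact (this.comp (f := fun z : (ℝ × ℝ) × ℝ => (z.1.1, z.2)) (by fun_prop)).pow 2

lemma continuous_convGreenDeriv (h : IsReducedSolution T M w wx) :
    Continuous fun z : ℝ × ℝ => convGreenDeriv (fun y => w z.1 y ^ 2) z.2 :=
  (h.continuous_right.sub h.continuous_left).div_const 2

lemma continuous_convGreen (h : IsReducedSolution T M w wx) :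
    Continuous fun z : ℝ × ℝ => convGreen (fun y => w z.1 y ^ 2) z.2 :=
  (h.continuous_right.add h.continuous_left).div_const 2

end IsReducedSolution
end GCH
end

noncomputable section
namespace GCH
open MeasureTheory Set Filter Topology

/-! ### Characteristics -/

namespace IsReducedSolution
variable {T M : ℝ} {w wx : ℝ → ℝ → ℝ}

/-- `q` is a characteristic curve on `[0,T]`. -/
def IsCharacteristic (T : ℝ) (w : ℝ → ℝ → ℝ) (q : ℝ → ℝ) : Prop :=
  ∀ τ ∈ Icc 0 T, HasDerivAt q (-2 * w τ (q τ)) τ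

lemma abs_sub_le (h : IsReducedSolution T M w wx) (t x y : ℝ) :
    |w t x - w t y| ≤ M * |x - y| := by
  have := Convex.norm_image_sub_le_of_norm_hasDerivWithin_le (s := univ)
    (fun z _ => (h.hasDerivAt_x t z).hasDerivWithinAt) (fun z _ => h.bound_x t z) convex_univ
    (mem_univ y) (mem_univ x)
  simpa using this

lemma exists_isCharacteristic (h : IsReducedSolution T M w wx) {t : ℝ} (ht : t ∈ Icc 0 T)
    (y : ℝ) : ∃ q : ℝ → ℝ, q t = y ∧ IsCharacteristic T w q := by
  have hM := h.bound_nonneg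
  have ht' : t ∈ Icc (-1) (T + 1) := ⟨by linarith [ht.1], by linarith [ht.2]⟩
  have hT := h.pos
  obtain ⟨K, hK⟩ : ∃ K : NNReal, (K : ℝ) = 2 * M := ⟨⟨2 * M, by positivity⟩, rfl⟩
  -- At speed at most 2M, a solution cannot leave a ball of radius 2M(T + 2) during the enlarged
  -- interval [-1, T + 1]. The enlargement makes the derivatives at 0 and T two-sided.
  obtain ⟨R, hR⟩ : ∃ R : NNReal, (R : ℝ) = 2 * M * (T + 2) :=
    ⟨⟨2 * M * (T + 2), by positivity⟩, rfl⟩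
  have hpl : IsPicardLindelof (fun τ x => -2 * w τ x) (⟨t, ht'⟩ : Icc (-1) (T + 1)) y
      R 0 K K := by
    refine ⟨fun τ _ => ?_, fun x _ => ?_, fun τ _ x _ => ?_, ?_⟩
    · refine LipschitzWith.lipschitzOnWith (LipschitzWith.of_dist_le_mul fun a b => ?_)
      rw [Real.dist_eq, Real.dist_eq, ← mul_sub, abs_mul, hK]
      have := h.abs_sub_le τ a b
      norm_num
      linarith
    · have : Continuous fun τ => w τ x := h.cont.comp (f := fun τ => (τ, x)) (by fun_prop)
      exact Continuous.continuousOn (by fun_prop)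
    · rw [Real.norm_eq_abs, abs_mul, hK]
      have := h.bound τ x
      norm_num
      linarith
    · rw [NNReal.coe_zero, sub_zero, hK, hR]
      have : max (T + 1 - t) (t - -1) ≤ T + 2 := max_le (by linarith [ht.1]) (by linarith [ht.2])
      exact mul_le_mul_of_nonneg_left this (by positivity)
  obtain ⟨q, hq, hd⟩ := hpl.exists_eq_forall_mem_Icc_hasDerivWithinAt₀
  refine ⟨q, hq, fun τ hτ => (hd τ ⟨by linarith [hτ.1], by linarith [hτ.2]⟩).hasDerivAt
    (Icc_mem_nhds (by linarith [hτ.1]) (by linarith [hτ.2]))⟩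

/-- Gronwall in both time directions, since x ↦ -2w(τ, x) is 2M-Lipschitz. It yields at once the
continuity of the flow and the fact that it neither contracts nor expands by more than e^{2MT}. -/
lemma isCharacteristic_dist_le (h : IsReducedSolution T M w wx) {q₁ q₂ : ℝ → ℝ}
    (h₁ : IsCharacteristic T w q₁) (h₂ : IsCharacteristic T w q₂) {τ σ : ℝ} (hτ : τ ∈ Icc 0 T)
    (hσ : σ ∈ Icc 0 T) : |q₁ τ - q₂ τ| ≤ Real.exp (2 * M * T) * |q₁ σ - q₂ σ| := by
  have hM := h.bound_nonneg
  set D : ℝ → ℝ := fun τ => q₁ τ - q₂ τ with hD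
  set D' : ℝ → ℝ := fun τ => -2 * w τ (q₁ τ) - -2 * w τ (q₂ τ) with hD'
  have hd : ∀ τ ∈ Icc 0 T, HasDerivAt D (D' τ) τ := fun τ hτ => (h₁ τ hτ).sub (h₂ τ hτ)
  have hb : ∀ τ, |D τ * D' τ| ≤ 2 * M * D τ ^ 2 := by
    intro τ
    have : |D' τ| ≤ 2 * M * |D τ| := by
      have := h.abs_sub_le τ (q₁ τ) (q₂ τ)
      simp only [hD', ← mul_sub, abs_mul]; norm_num; linarith
    rw [abs_mul, ← sq_abs (D τ)]
    nlinarith [abs_nonneg (D τ)]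
  have hE : ∀ k τ : ℝ, HasDerivAt (fun τ => Real.exp (k * τ)) (k * Real.exp (k * τ)) τ := by
    intro k τ
    have := ((hasDerivAt_id τ).const_mul k).exp
    simpa [mul_comm] using this
  have hg : ∀ k, ∀ τ ∈ Icc 0 T, HasDerivAt (fun τ => D τ ^ 2 * Real.exp (k * τ))
      ((2 * (D τ * D' τ) + k * D τ ^ 2) * Real.exp (k * τ)) τ := fun k τ hτ =>
    (((hd τ hτ).pow 2).mul (hE k τ)).congr_deriv (by push_cast; simp; ring)
  -- From |(D²)'| ≤ 4M D², the function D² e^{4Mτ} is nondecreasing and D² e^{-4Mτ} is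
  -- nonincreasing; these serve τ ≤ σ and σ ≤ τ respectively. The square root halves the exponent
  -- 4MT.
  have key : D τ ^ 2 ≤ Real.exp (4 * M * T) * D σ ^ 2 := by
    rcases le_total τ σ with hle | hle
    · have mono : MonotoneOn (fun τ => D τ ^ 2 * Real.exp (4 * M * τ)) (Icc 0 T) := by
        refine monotoneOn_of_deriv_nonneg (convex_Icc _ _)
          (fun τ hτ => (hg _ τ hτ).continuousAt.continuousWithinAt)
          (fun τ hτ => (hg _ τ (interior_subset hτ)).differentiableAt.differentiableWithinAt)
          fun τ hτ => ?_
        rw [(hg _ τ (interior_subset hτ)).deriv]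
        have := abs_le.1 (hb τ)
        exact mul_nonneg (by linarith) (Real.exp_pos _).le
      have h1 := mono hτ hσ hle
      simp only at h1
      calc D τ ^ 2 ≤ D τ ^ 2 * Real.exp (4 * M * τ) :=
            le_mul_of_one_le_right (sq_nonneg _) (Real.one_le_exp (by have := hτ.1; positivity))
        _ ≤ _ := h1
        _ ≤ _ := by
            rw [mul_comm]
            gcongr
            exact hσ.2
    · have mono : AntitoneOn (fun τ => D τ ^ 2 * Real.exp (-(4 * M) * τ)) (Icc 0 T) := by
        refine antitoneOn_of_deriv_nonpos (convex_Icc _ _)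
          (fun τ hτ => (hg _ τ hτ).continuousAt.continuousWithinAt)
          (fun τ hτ => (hg _ τ (interior_subset hτ)).differentiableAt.differentiableWithinAt)
          fun τ hτ => ?_
        rw [(hg _ τ (interior_subset hτ)).deriv]
        have := abs_le.1 (hb τ)
        exact mul_nonpos_of_nonpos_of_nonneg (by linarith) (Real.exp_pos _).le
      have h1 := mono hσ hτ hle
      simp only at h1
      have h2 : D τ ^ 2 * Real.exp (-(4 * M) * τ) * Real.exp (4 * M * τ) = D τ ^ 2 := by
        rw [mul_assoc, ← Real.exp_add]; simp
      calc D τ ^ 2 = _ := h2.symm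
        _ ≤ D σ ^ 2 * Real.exp (-(4 * M) * σ) * Real.exp (4 * M * τ) := by gcongr
        _ = D σ ^ 2 * Real.exp (4 * M * (τ - σ)) := by rw [mul_assoc, ← Real.exp_add]; ring_nf
        _ ≤ Real.exp (4 * M * T) * D σ ^ 2 := by
            rw [mul_comm]
            gcongr
            linarith [hτ.2, hσ.1]
  refine abs_le_of_sq_le_sq' ?_ (by positivity) |> abs_le.2
  rw [mul_pow, sq_abs, ← Real.exp_nat_mul]
  calc _ ≤ _ := key
    _ = _ := by congr 2; push_cast; ring

lemma abs_isCharacteristic_sub_le (h : IsReducedSolution T M w wx) {q : ℝ → ℝ}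
    (hq : IsCharacteristic T w q) {τ σ : ℝ} (hτ : τ ∈ Icc 0 T) (hσ : σ ∈ Icc 0 T) :
    |q τ - q σ| ≤ 2 * M * |τ - σ| :=
  Convex.norm_image_sub_le_of_norm_hasDerivWithin_le (s := Icc 0 T)
    (fun z hz => (hq z hz).hasDerivWithinAt)
    (fun z _ => by
      rw [norm_mul]
      have := h.bound z (q z)
      rw [← Real.norm_eq_abs] at this
      norm_num at this ⊢
      linarith) (convex_Icc _ _) hσ hτ

/-- The transport term -2w w_x cancels 2w w_x, leaving the nonlocal source. The chain rule needs
joint differentiability of w, which follows from the joint continuity of both partial derivatives;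
the one in t is available only for times in (0, T). -/
lemma hasDerivAt_comp_isCharacteristic (h : IsReducedSolution T M w wx) {q : ℝ → ℝ}
    (hq : IsCharacteristic T w q) {t : ℝ} (ht : t ∈ Ioo 0 T) :
    HasDerivAt (fun τ => w τ (q τ)) (3 * convGreenDeriv (fun y => w t y ^ 2) (q t)) t := by
  have hc := h.cont
  have hcx := h.cont_x
  have hcF := h.continuous_convGreenDeriv
  have hs := hasStrictFDerivAt_uncurry_coprod (𝕜 := ℝ) (u := (t, q t)) (f := w)
    (f₁ := fun t x => ContinuousLinearMap.toSpanSingleton ℝ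
      (2 * w t x * wx t x + 3 * convGreenDeriv (fun y => w t y ^ 2) x))
    (f₂ := fun t x => ContinuousLinearMap.toSpanSingleton ℝ (wx t x))
    (by
      have : ∀ᶠ v : ℝ × ℝ in 𝓝 (t, q t), v.1 ∈ Ioo 0 T :=
        continuous_fst.continuousAt.eventually_mem (isOpen_Ioo.mem_nhds ht)
      filter_upwards [this] with v hv
      exact (h.hasDerivAt_t v.1 hv v.2).hasFDerivAt)
    (Eventually.of_forall fun v => (h.hasDerivAt_x v.1 v.2).hasFDerivAt)
    (by
      refine Continuous.continuousAt ?_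
      refine (ContinuousLinearMap.toSpanSingletonCLE (𝕜 := ℝ) (E := ℝ)).continuous.comp
        (g := fun a => ContinuousLinearMap.toSpanSingleton ℝ a) ?_
      exact ((hc.const_mul 2).mul hcx).add (hcF.const_mul 3))
    (by
      refine Continuous.continuousAt ?_
      exact (ContinuousLinearMap.toSpanSingletonCLE (𝕜 := ℝ) (E := ℝ)).continuous.comp
        (g := fun a => ContinuousLinearMap.toSpanSingleton ℝ a) hcx)
  have hd : HasDerivAt (fun τ => (τ, q τ)) (1, -2 * w t (q t)) t :=
    (hasDerivAt_id t).prodMk (hq t (Ioo_subset_Icc_self ht))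
  refine (hs.hasFDerivAt.comp_hasDerivAt t hd).congr_deriv ?_
  simp [Function.HasUncurry.uncurry]

lemma eq_integral_isCharacteristic (h : IsReducedSolution T M w wx) {q : ℝ → ℝ}
    (hq : IsCharacteristic T w q) {t : ℝ} (ht : t ∈ Icc 0 T) :
    w t (q t) = w 0 (q 0) +
      ∫ τ in (0 : ℝ)..t, 3 * convGreenDeriv (fun y => w τ y ^ 2) (q τ) := by
  have hqc : ContinuousOn q (Icc 0 t) := fun τ hτ =>
    (hq τ ⟨hτ.1, hτ.2.trans ht.2⟩).continuousAt.continuousWithinAt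
  have hp : ContinuousOn (fun τ => (τ, q τ)) (Icc 0 t) := continuousOn_id.prodMk hqc
  have h1 : ContinuousOn (fun τ => w τ (q τ)) (Icc 0 t) := h.cont.comp_continuousOn hp
  have h2 : ContinuousOn (fun τ => 3 * convGreenDeriv (fun y => w τ y ^ 2) (q τ)) (Icc 0 t) :=
    (h.continuous_convGreenDeriv.comp_continuousOn hp).const_mul 3 (f := _)
  rw [intervalIntegral.integral_eq_sub_of_hasDerivAt_of_le ht.1 h1
    (fun τ hτ => h.hasDerivAt_comp_isCharacteristic hq ⟨hτ.1, hτ.2.trans_le ht.2⟩)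
    (ContinuousOn.intervalIntegrable (by rwa [uIcc_of_le ht.1]))]
  ring

open Classical in
/-- The flow of the characteristics: `flow T w t y τ` is the position at time `τ` of the
characteristic through `y` at time `t`. -/
def flow (T : ℝ) (w : ℝ → ℝ → ℝ) (t y : ℝ) : ℝ → ℝ :=
  if h : ∃ q : ℝ → ℝ, q t = y ∧ IsCharacteristic T w q then h.choose else 0

lemma flow_spec (h : IsReducedSolution T M w wx) {t : ℝ} (ht : t ∈ Icc 0 T) (y : ℝ) :
    flow T w t y t = y ∧ IsCharacteristic T w (flow T w t y) := by
  have he := h.exists_isCharacteristic ht y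
  rw [flow, dif_pos he]
  exact he.choose_spec

end IsReducedSolution
end GCH
end

/-! ### Pointwise bounds for w and w_x along characteristics -/

noncomputable section
namespace GCH
open MeasureTheory Set Filter Topology

lemma halfLineIntegral_nonneg {c : ℝ} {f : ℝ → ℝ} (hf : ∀ x, 0 ≤ f x) (x : ℝ) :
    0 ≤ halfLineIntegral c f x :=
  integral_nonneg fun _ => mul_nonneg (Real.exp_pos _).le (hf _)

lemma abs_halfLineIntegral_one_le {K : ℝ} {f : ℝ → ℝ} (hf : ∀ x, |f x| ≤ K) (x : ℝ) :
    |halfLineIntegral 1 f x| ≤ K := by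
  have h1 : ∫ z in Ioi (0 : ℝ), Real.exp (-1 * z) * K = K := by
    rw [integral_mul_const]
    simp only [neg_mul, one_mul]
    rw [integral_exp_neg_Ioi_zero, one_mul]
  rw [← h1, halfLineIntegral, ← Real.norm_eq_abs]
  refine norm_integral_le_of_norm_le ((exp_neg_integrableOn_Ioi 0 one_pos).mul_const K)
    (Eventually.of_forall fun z => ?_)
  rw [norm_mul, Real.norm_of_nonneg (Real.exp_pos _).le]
  exact mul_le_mul_of_nonneg_left (hf _) (Real.exp_pos _).le

lemma convGreen_nonneg {q : ℝ → ℝ} (hq : ∀ x, 0 ≤ q x) (x : ℝ) : 0 ≤ convGreen q x := by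
  have h1 := halfLineIntegral_nonneg (c := 1) hq x
  have h2 := halfLineIntegral_nonneg (c := 1) (fun x => hq (-x)) (-x)
  rw [convGreen]; linarith

lemma abs_convGreenDeriv_le {q : ℝ → ℝ} (hq : ∀ x, 0 ≤ q x) (x : ℝ) :
    |convGreenDeriv q x| ≤ convGreen q x := by
  have h1 := halfLineIntegral_nonneg (c := 1) hq x
  have h2 := halfLineIntegral_nonneg (c := 1) (fun x => hq (-x)) (-x)
  rw [convGreen, convGreenDeriv, abs_le]
  constructor <;> linarith

lemma convGreen_le {q : ℝ → ℝ} {K : ℝ} (hq : ∀ x, |q x| ≤ K) (x : ℝ) : convGreen q x ≤ K := by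
  have h1 := (abs_le.1 (abs_halfLineIntegral_one_le hq x)).2
  have h2 := (abs_le.1 (abs_halfLineIntegral_one_le (fun x => hq (-x)) (-x))).2
  rw [convGreen]; linarith

namespace IsReducedSolution
variable {T M : ℝ} {w wx : ℝ → ℝ → ℝ}

lemma abs_le_flow (h : IsReducedSolution T M w wx) {t : ℝ} (ht : t ∈ Icc 0 T) (y : ℝ) :
    |w t y| ≤ |w 0 (flow T w t y 0)| +
      ∫ τ in (0 : ℝ)..t, 3 * convGreen (fun z => w τ z ^ 2) (flow T w t y τ) := by
  obtain ⟨hy, hq⟩ := h.flow_spec ht y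
  have h1 := h.eq_integral_isCharacteristic hq ht
  rw [hy] at h1
  rw [h1]
  have hqc : ContinuousOn (flow T w t y) (Icc 0 t) := fun τ hτ =>
    (hq τ ⟨hτ.1, hτ.2.trans ht.2⟩).continuousAt.continuousWithinAt
  have hp : ContinuousOn (fun τ => (τ, flow T w t y τ)) (Icc 0 t) := continuousOn_id.prodMk hqc
  have h2 : ContinuousOn (fun τ => 3 * convGreen (fun z => w τ z ^ 2) (flow T w t y τ))
    (Icc 0 t) := (h.continuous_convGreen.comp_continuousOn hp).const_mul 3 (f := _)
  refine (abs_add_le _ _).trans (add_le_add le_rfl ?_)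
  rw [← Real.norm_eq_abs]
  refine intervalIntegral.norm_integral_le_of_norm_le ht.1 (Eventually.of_forall fun τ _ => ?_)
    (ContinuousOn.intervalIntegrable (by rwa [uIcc_of_le ht.1]))
  rw [norm_mul]
  have := abs_convGreenDeriv_le (fun z => sq_nonneg (w τ z)) (flow T w t y τ)
  norm_num
  linarith

lemma abs_convGreen_sub_le (f : ℝ → ℝ) (x : ℝ) :
    |convGreen (fun y => f y ^ 2) x - f x ^ 2| ≤ convGreen (fun y => f y ^ 2) x + f x ^ 2 := by
  have h1 := convGreen_nonneg (fun z => sq_nonneg (f z)) x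
  have := sq_nonneg (f x)
  rw [abs_le]; constructor <;> linarith

/-- The derivative of the nonlocal term is G * w² - w², and each of the two pieces is at most M². -/
lemma abs_convGreenDeriv_sub_le (h : IsReducedSolution T M w wx) {t : ℝ} (ht : t ∈ Ioo 0 T)
    (x y : ℝ) : |convGreenDeriv (fun y => w t y ^ 2) x - convGreenDeriv (fun y => w t y ^ 2) y| ≤
      2 * M ^ 2 * |x - y| := by
  have := Convex.norm_image_sub_le_of_norm_hasDerivWithin_le (s := univ)
    (fun z _ => (h.hasDerivAt_convGreenDeriv t ht z).hasDerivWithinAt) (C := 2 * M ^ 2)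
    (fun z _ => by
      refine (abs_convGreen_sub_le (w t) z).trans ?_
      have h1 := convGreen_le (h.sq_le t) z
      have h2 := h.sq_le t z
      rw [abs_of_nonneg (sq_nonneg _)] at h2
      linarith) convex_univ
    (mem_univ y) (mem_univ x)
  simpa using this

-- Differentiating the equation in x would require w_xx, that is, three derivatives of u. Instead,
-- subtract the integral formulas for w along two neighbouring characteristics, divide by y' - y and
-- let y' → y. Each difference quotient in y is a slope at q(τ) times a distortion of the flow that
-- is at most E.
set_option maxHeartbeats 1000000 in
lemma abs_deriv_le_flow (h : IsReducedSolution T M w wx) {t : ℝ} (ht : t ∈ Icc 0 T) (y : ℝ) :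
    |wx t y| ≤ Real.exp (2 * M * T) * (|wx 0 (flow T w t y 0)| +
      ∫ τ in (0 : ℝ)..t, 3 * (convGreen (fun z => w τ z ^ 2) (flow T w t y τ) +
        w τ (flow T w t y τ) ^ 2)) := by
  set E := Real.exp (2 * M * T) with hE
  have hE0 : 0 < E := Real.exp_pos _
  obtain ⟨hy, hq⟩ := h.flow_spec ht y
  set q := flow T w t y with hqdef
  set Q : ℝ → ℝ → ℝ := fun y' => flow T w t y' with hQ
  have hQ1 : ∀ y', Q y' t = y' := fun y' => (h.flow_spec ht y').1
  have hQ2 : ∀ y', IsCharacteristic T w (Q y') := fun y' => (h.flow_spec ht y').2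
  have sub : ∀ τ ∈ Icc 0 t, τ ∈ Icc 0 T := fun τ hτ => ⟨hτ.1, hτ.2.trans ht.2⟩
  have h0T : (0 : ℝ) ∈ Icc 0 T := ⟨le_rfl, h.pos.le⟩
  have up : ∀ y', ∀ τ ∈ Icc 0 T, |Q y' τ - q τ| ≤ E * |y' - y| := by
    intro y' τ hτ
    have := h.isCharacteristic_dist_le (hQ2 y') hq hτ ht
    rwa [hQ1, hy] at this
  have low : ∀ y', ∀ τ ∈ Icc 0 T, |y' - y| ≤ E * |Q y' τ - q τ| := by
    intro y' τ hτ
    have := h.isCharacteristic_dist_le (hQ2 y') hq ht hτ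
    rwa [hQ1, hy] at this
  -- The lower bound on the flow keeps distinct characteristics apart, so slopes at q(τ) are taken
  -- along a punctured neighbourhood.
  have lim : ∀ τ ∈ Icc 0 T, Tendsto (fun y' => Q y' τ) (𝓝[≠] y) (𝓝[≠] (q τ)) := by
    intro τ hτ
    refine tendsto_nhdsWithin_iff.2 ⟨?_, ?_⟩
    · rw [tendsto_iff_dist_tendsto_zero]
      refine squeeze_zero (fun _ => dist_nonneg) (fun y' => up y' τ hτ) ?_
      have : Tendsto (fun y' => E * |y' - y|) (𝓝 y) (𝓝 (E * |y - y|)) :=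
        Continuous.tendsto (by fun_prop) y
      simp only [sub_self, abs_zero, mul_zero] at this
      exact this.mono_left nhdsWithin_le_nhds
    · filter_upwards [self_mem_nhdsWithin] with y' hy' heq
      have := low y' τ hτ
      rw [mem_singleton_iff.1 heq, sub_self, abs_zero, mul_zero] at this
      exact hy' (by simpa [sub_eq_zero] using this)
  have slope_le : ∀ (g : ℝ → ℝ) (y' τ : ℝ), τ ∈ Icc 0 T → y' ≠ y →
      |g (Q y' τ) - g (q τ)| ≤ E * |slope g (q τ) (Q y' τ)| * |y' - y| := by
    intro g y' τ hτ hne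
    have hl := low y' τ hτ
    have hu := up y' τ hτ
    have hpos : 0 < |y' - y| := abs_pos.2 (sub_ne_zero.2 hne)
    have hpos2 : 0 < |Q y' τ - q τ| := by
      have h1 : 0 < E * |Q y' τ - q τ| := hpos.trans_le hl
      exact (mul_pos_iff_of_pos_left hE0).1 h1
    rw [slope_def_field, abs_div]
    have e1 : |g (Q y' τ) - g (q τ)| = |g (Q y' τ) - g (q τ)| / |Q y' τ - q τ| * |Q y' τ - q τ| :=
      (div_mul_cancel₀ _ hpos2.ne').symm
    have e2 := mul_le_mul_of_nonneg_left hu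
      (div_nonneg (abs_nonneg (g (Q y' τ) - g (q τ))) hpos2.le)
    rw [← e1] at e2
    rw [mul_assoc, mul_left_comm]
    exact e2
  obtain ⟨F, hF, hFeq⟩ : ∃ F : ℝ → ℝ → ℝ, Continuous (fun z : ℝ × ℝ => F z.1 z.2) ∧
      ∀ τ, F τ = convGreenDeriv (fun y => w τ y ^ 2) :=
    ⟨fun τ => convGreenDeriv (fun y => w τ y ^ 2), h.continuous_convGreenDeriv, fun _ => rfl⟩
  have hqc : ∀ y', ContinuousOn (Q y') (Icc 0 t) := fun y' τ hτ =>
    (hQ2 y' τ (sub τ hτ)).continuousAt.continuousWithinAt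
  have hp : ∀ y', ContinuousOn (fun τ => (τ, Q y' τ)) (Icc 0 t) := fun y' =>
    continuousOn_id.prodMk (hqc y')
  have hFc : ∀ y', ContinuousOn (fun τ => F τ (Q y' τ)) (Icc 0 t) := fun y' =>
    hF.comp_continuousOn (hp y')
  have hsc : ∀ y' ≠ y, ContinuousOn (fun τ => E * |slope (F τ) (q τ) (Q y' τ)|) (Icc 0 t) := by
    intro y' hne
    simp only [slope_def_field]
    refine continuousOn_const.mul (ContinuousOn.abs
      (((hFc y').sub (hFc y)).div ((hqc y').sub (hqc y)) fun τ hτ heq => ?_))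
    have := low y' τ (sub τ hτ)
    have heq' : Q y' τ - q τ = 0 := heq
    rw [heq', abs_zero, mul_zero] at this
    exact hne (by simpa [sub_eq_zero] using this)
  have main : ∀ y' ≠ y, |slope (w t) y y'| ≤ E * |slope (w 0) (q 0) (Q y' 0)| +
      ∫ τ in (0 : ℝ)..t, 3 * (E * |slope (F τ) (q τ) (Q y' τ)|) := by
    intro y' hne
    have hpos : 0 < |y' - y| := abs_pos.2 (sub_ne_zero.2 hne)
    have e1 := h.eq_integral_isCharacteristic (hQ2 y') ht
    have e2 := h.eq_integral_isCharacteristic hq ht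
    simp only [← hFeq] at e1 e2
    rw [hQ1] at e1
    rw [hy] at e2
    rw [slope_def_field, abs_div, div_le_iff₀ hpos, e1, e2, add_mul]
    have i1 : ∀ y', IntervalIntegrable (fun τ => 3 * F τ (Q y' τ)) volume 0 t := fun y' =>
      ContinuousOn.intervalIntegrable (by rw [uIcc_of_le ht.1]; exact (hFc y').const_mul 3 (f := _))
    have e3 : w 0 (Q y' 0) + (∫ τ in (0 : ℝ)..t, 3 * F τ (Q y' τ)) -
        (w 0 (q 0) + ∫ τ in (0 : ℝ)..t, 3 * F τ (q τ)) = (w 0 (Q y' 0) - w 0 (q 0)) +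
        ∫ τ in (0 : ℝ)..t, (3 * F τ (Q y' τ) - 3 * F τ (q τ)) := by
      rw [intervalIntegral.integral_sub (i1 y') (i1 y)]; ring
    rw [e3]
    have b1 : |w 0 (Q y' 0) - w 0 (q 0)| ≤ E * |slope (w 0) (q 0) (Q y' 0)| * |y' - y| :=
      slope_le (w 0) y' 0 h0T hne
    have b2 : ∀ᵐ τ, τ ∈ Ioc 0 t → ‖3 * F τ (Q y' τ) - 3 * F τ (q τ)‖ ≤
        3 * (E * |slope (F τ) (q τ) (Q y' τ)|) * |y' - y| := by
      refine Eventually.of_forall fun τ hτ => ?_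
      have := slope_le (F τ) y' τ (sub τ (Ioc_subset_Icc_self hτ)) hne
      rw [← mul_sub, norm_mul, Real.norm_eq_abs (F τ _ - _)]
      norm_num
      linarith
    have b3 : IntervalIntegrable (fun τ => 3 * (E * |slope (F τ) (q τ) (Q y' τ)|) * |y' - y|)
        volume 0 t := ContinuousOn.intervalIntegrable (by
      rw [uIcc_of_le ht.1]
      exact (continuousOn_const.mul (hsc y' hne)).mul continuousOn_const)
    have b4 := intervalIntegral.norm_integral_le_of_norm_le ht.1 b2 b3
    rw [intervalIntegral.integral_mul_const, Real.norm_eq_abs] at b4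
    exact (abs_add_le _ _).trans (add_le_add b1 b4)
  have hmem : ∀ᶠ y' in 𝓝[≠] y, y' ≠ y := self_mem_nhdsWithin
  -- The endpoint τ = t may equal T, where the derivative of the nonlocal term is not provided; it
  -- is a null set for the integral.
  have ae_ne : ∀ᵐ τ : ℝ, τ ≠ t := by
    simp [ae_iff, measure_singleton]
  -- Dominated convergence: the slopes of the nonlocal term are bounded by its Lipschitz constant
  -- 2M².
  have lim_int : Tendsto (fun y' => ∫ τ in (0 : ℝ)..t, 3 * (E * |slope (F τ) (q τ) (Q y' τ)|))
      (𝓝[≠] y) (𝓝 (∫ τ in (0 : ℝ)..t, 3 * (E * |convGreen (fun z => w τ z ^ 2) (q τ) -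
        w τ (q τ) ^ 2|))) := by
    have c1 : ∀ᶠ y' in 𝓝[≠] y, AEStronglyMeasurable
        (fun τ => 3 * (E * |slope (F τ) (q τ) (Q y' τ)|)) (volume.restrict (uIoc 0 t)) := by
      filter_upwards [hmem] with y' hne
      have := (continuousOn_const (c := (3 : ℝ)).mul (hsc y' hne)).aestronglyMeasurable
        (μ := volume) measurableSet_Icc
      rw [uIoc_of_le ht.1]
      exact this.mono_measure (Measure.restrict_mono Ioc_subset_Icc_self le_rfl)
    have c2 : ∀ᶠ y' in 𝓝[≠] y, ∀ᵐ τ, τ ∈ uIoc 0 t →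
        ‖3 * (E * |slope (F τ) (q τ) (Q y' τ)|)‖ ≤ 3 * (E * (2 * M ^ 2)) := by
      filter_upwards [hmem] with y' hne
      filter_upwards [ae_ne] with τ hτne hτ
      rw [uIoc_of_le ht.1] at hτ
      have hτ' : τ ∈ Ioo 0 T := ⟨hτ.1, (lt_of_le_of_ne hτ.2 hτne).trans_le ht.2⟩
      have hb := h.abs_convGreenDeriv_sub_le hτ' (Q y' τ) (q τ)
      rw [← hFeq] at hb
      rw [Real.norm_of_nonneg (by positivity), slope_def_field, abs_div]
      have : |F τ (Q y' τ) - F τ (q τ)| / |Q y' τ - q τ| ≤ 2 * M ^ 2 :=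
        div_le_of_le_mul₀ (abs_nonneg _) (by positivity) hb
      gcongr
    have c3 : ∀ᵐ τ, τ ∈ uIoc 0 t → Tendsto (fun y' => 3 * (E * |slope (F τ) (q τ) (Q y' τ)|))
        (𝓝[≠] y) (𝓝 (3 * (E * |convGreen (fun z => w τ z ^ 2) (q τ) - w τ (q τ) ^ 2|))) := by
      filter_upwards [ae_ne] with τ hτne hτ
      rw [uIoc_of_le ht.1] at hτ
      have hτ' : τ ∈ Ioo 0 T := ⟨hτ.1, (lt_of_le_of_ne hτ.2 hτne).trans_le ht.2⟩
      have := (hasDerivAt_iff_tendsto_slope.1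
        (h.hasDerivAt_convGreenDeriv τ hτ' (q τ))).comp (lim τ (Ioo_subset_Icc_self hτ'))
      rw [← hFeq] at this
      exact (this.abs.const_mul E).const_mul 3
    exact intervalIntegral.tendsto_integral_filter_of_dominated_convergence
      (fun _ => 3 * (E * (2 * M ^ 2))) c1 c2 (by simp) c3
  have lim_left : Tendsto (fun y' => |slope (w t) y y'|) (𝓝[≠] y) (𝓝 |wx t y|) :=
    (hasDerivAt_iff_tendsto_slope.1 (h.hasDerivAt_x t y)).abs
  have lim_right : Tendsto (fun y' => E * |slope (w 0) (q 0) (Q y' 0)|) (𝓝[≠] y)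
      (𝓝 (E * |wx 0 (q 0)|)) :=
    (((hasDerivAt_iff_tendsto_slope.1 (h.hasDerivAt_x 0 (q 0))).comp (lim 0 h0T)).abs).const_mul E
  have fin := le_of_tendsto_of_tendsto lim_left (lim_right.add lim_int) (by
    filter_upwards [hmem] with y' hne using main y' hne)
  refine fin.trans ?_
  rw [mul_add, ← intervalIntegral.integral_const_mul]
  have hG : ContinuousOn (fun τ => convGreen (fun z => w τ z ^ 2) (q τ)) (Icc 0 t) :=
    Continuous.comp_continuousOn (g := fun z : ℝ × ℝ => convGreen (fun y => w z.1 y ^ 2) z.2)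
      h.continuous_convGreen (hp y)
  have hW : ContinuousOn (fun τ => w τ (q τ)) (Icc 0 t) :=
    Continuous.comp_continuousOn (g := fun z : ℝ × ℝ => w z.1 z.2) h.cont (hp y)
  have hW2 : ContinuousOn (fun τ => w τ (q τ) ^ 2) (Icc 0 t) := hW.pow 2
  refine add_le_add le_rfl (intervalIntegral.integral_mono_on ht.1 ?_ ?_ fun τ _ => ?_)
  · refine ContinuousOn.intervalIntegrable ?_
    rw [uIcc_of_le ht.1]
    exact continuousOn_const.mul (continuousOn_const.mul (hG.sub hW2).abs)
  · refine ContinuousOn.intervalIntegrable ?_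
    rw [uIcc_of_le ht.1]
    exact continuousOn_const.mul (continuousOn_const.mul (hG.add hW2))
  · have := abs_convGreen_sub_le (w τ) (q τ)
    calc _ ≤ 3 * (E * (convGreen (fun z => w τ z ^ 2) (q τ) + w τ (q τ) ^ 2)) := by gcongr
      _ = _ := by ring

end IsReducedSolution
end GCH
end

noncomputable section
namespace GCH
open MeasureTheory Set Filter Topology
open scoped ENNReal

/-! ### Minkowski's and Young's inequalities -/

/-- A form of Minkowski's integral inequality. -/
lemma eLpNorm_lintegral_le {X Y : Type*} [MeasurableSpace X] [MeasurableSpace Y] {μ : Measure X}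
    {ν : Measure Y} [SFinite μ] [IsFiniteMeasure ν] {p K : ℝ≥0∞} (hp : 1 ≤ p) {f : X → Y → ℝ≥0∞}
    (hf : Measurable (Function.uncurry f)) (hK : ∀ᵐ y ∂ν, eLpNorm (fun x => f x y) p μ ≤ K) :
    eLpNorm (fun x => ∫⁻ y, f x y ∂ν) p μ ≤ K * ν univ := by
  rcases eq_or_ne p ⊤ with rfl | htop
  · have h1 : ∀ᵐ y ∂ν, ∀ᵐ x ∂μ, f x y ≤ K := by
      filter_upwards [hK] with y hy
      filter_upwards [ae_le_eLpNormEssSup (f := fun x => f x y) (μ := μ)] with x hx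
      exact hx.trans (by rwa [eLpNorm_exponent_top] at hy)
    -- For p = ∞, Fubini exchanges the order of the two almost-everywhere quantifiers.
    have h2 : ∀ᵐ x ∂μ, ∀ᵐ y ∂ν, f x y ≤ K :=
      (Measure.ae_ae_comm (p := fun x y => f x y ≤ K)
        (measurableSet_le hf measurable_const)).2 h1
    refine eLpNorm_le_of_ae_enorm_bound (C := K * ν univ) ?_ |>.trans ?_
    · filter_upwards [h2] with x hx
      exact (lintegral_mono_ae hx).trans (by simp)
    · simp
  · have hp0 : p ≠ 0 := (zero_lt_one.trans_le hp).ne'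
    set r := p.toReal with hr
    have hr1 : 1 ≤ r := by
      rw [hr, ← ENNReal.toReal_one]; exact ENNReal.toReal_mono htop hp
    have hr0 : 0 < r := zero_lt_one.trans_le hr1
    simp only [eLpNorm_eq_lintegral_rpow_enorm_toReal hp0 htop, enorm_eq_self, ← hr] at hK ⊢
    -- For finite p, Hölder against the constant 1 on a finite measure, followed by Tonelli.
    have jensen : ∀ x, (∫⁻ y, f x y ∂ν) ^ r ≤ ν univ ^ (r - 1) * ∫⁻ y, f x y ^ r ∂ν := by
      intro x
      have hx : AEMeasurable (f x) ν := (hf.comp measurable_prodMk_left).aemeasurable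
      rcases hr1.eq_or_lt with h1 | h1
      · rw [← h1]; simp
      have hc : r.HolderConjugate r.conjExponent := Real.HolderConjugate.conjExponent h1
      have := ENNReal.lintegral_mul_le_Lp_mul_Lq ν hc hx (g := fun _ => 1) aemeasurable_const
      simp only [Pi.mul_apply, mul_one, ENNReal.one_rpow, lintegral_one] at this
      calc (∫⁻ y, f x y ∂ν) ^ r ≤
          ((∫⁻ y, f x y ^ r ∂ν) ^ (1 / r) * ν univ ^ (1 / r.conjExponent)) ^ r := by gcongr
        _ = ν univ ^ (r - 1) * ∫⁻ y, f x y ^ r ∂ν := by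
          rw [ENNReal.mul_rpow_of_nonneg _ _ hr0.le, ← ENNReal.rpow_mul, ← ENNReal.rpow_mul,
            one_div_mul_cancel hr0.ne', ENNReal.rpow_one, mul_comm]
          congr 2
          rw [Real.conjExponent]
          field_simp
    have hK' : ∀ᵐ y ∂ν, ∫⁻ x, f x y ^ r ∂μ ≤ K ^ r := by
      filter_upwards [hK] with y hy
      calc ∫⁻ x, f x y ^ r ∂μ = ((∫⁻ x, f x y ^ r ∂μ) ^ (1 / r)) ^ r := by
            rw [← ENNReal.rpow_mul, one_div_mul_cancel hr0.ne', ENNReal.rpow_one]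
        _ ≤ K ^ r := by gcongr
    have hm : Measurable (Function.uncurry fun x y => f x y ^ r) := hf.pow_const r
    have hm2 : Measurable fun x => ∫⁻ y, f x y ^ r ∂ν := hm.lintegral_prod_right'
    calc (∫⁻ x, (∫⁻ y, f x y ∂ν) ^ r ∂μ) ^ (1 / r)
        ≤ (∫⁻ x, ν univ ^ (r - 1) * ∫⁻ y, f x y ^ r ∂ν ∂μ) ^ (1 / r) := by
          gcongr with x; exact jensen x
      _ = (ν univ ^ (r - 1) * ∫⁻ y, ∫⁻ x, f x y ^ r ∂μ ∂ν) ^ (1 / r) := by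
          rw [lintegral_const_mul _ hm2, lintegral_lintegral_swap hm.aemeasurable]
      _ ≤ (ν univ ^ (r - 1) * (K ^ r * ν univ)) ^ (1 / r) := by
          gcongr
          exact (lintegral_mono_ae hK').trans (by simp)
      _ = ((K * ν univ) ^ r) ^ (1 / r) := by
          congr 1
          have : ν univ ^ r = ν univ ^ (r - 1) * ν univ := by
            have := ENNReal.rpow_add_of_nonneg (x := ν univ) (r - 1) 1 (by linarith) zero_le_one
            rwa [sub_add_cancel, ENNReal.rpow_one] at this
          rw [ENNReal.mul_rpow_of_nonneg _ _ hr0.le, this]; ring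
      _ = K * ν univ := by
          rw [← ENNReal.rpow_mul, mul_one_div_cancel hr0.ne', ENNReal.rpow_one]

lemma eLpNorm_comp_of_measurePreserving {p : ℝ≥0∞} {h : ℝ → ℝ≥0∞} (hh : Measurable h) {f : ℝ → ℝ}
    (hf : MeasurePreserving f volume volume) : eLpNorm (fun x => h (f x)) p = eLpNorm h p :=
  eLpNorm_comp_measurePreserving hh.aestronglyMeasurable hf

/-- Young's inequality `L¹ * L^p ⊆ L^p`, for correlations. -/
lemma eLpNorm_lintegral_mul_add_le {p : ℝ≥0∞} (hp : 1 ≤ p) {k h : ℝ → ℝ≥0∞}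
    (hk : AEMeasurable k) (hk' : ∫⁻ z, k z ≠ ⊤) (hh : Measurable h) :
    eLpNorm (fun x => ∫⁻ z, k z * h (x + z)) p ≤ (∫⁻ z, k z) * eLpNorm h p := by
  -- The integrable factor is absorbed in the measure, so Young's inequality becomes Minkowski's for
  -- translates, all of which have the same norm.
  have hfin : IsFiniteMeasure (volume.withDensity k) := isFiniteMeasure_withDensity hk'
  have h0 : ∀ᵐ z ∂volume.withDensity k, eLpNorm (fun x => h (x + z)) p ≤ eLpNorm h p :=
    Eventually.of_forall fun z =>
      (eLpNorm_comp_of_measurePreserving hh (measurePreserving_add_right volume z)).le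
  have hm : Measurable (Function.uncurry fun x z => h (x + z)) :=
    hh.comp (measurable_fst.add measurable_snd)
  have h1 := eLpNorm_lintegral_le (μ := volume) (ν := volume.withDensity k) hp hm h0
  rw [withDensity_apply _ MeasurableSet.univ, Measure.restrict_univ, mul_comm] at h1
  refine le_trans (le_of_eq ?_) h1
  congr 1
  ext x
  rw [lintegral_withDensity_eq_lintegral_mul₀ hk (g := fun z => h (x + z))
    (hh.comp (measurable_const.add measurable_id)).aemeasurable]
  rfl

/-- Young's inequality `L^p * L¹ ⊆ L^p`, for convolutions. -/
lemma eLpNorm_lintegral_mul_sub_le {p : ℝ≥0∞} (hp : 1 ≤ p) {k h : ℝ → ℝ≥0∞}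
    (hk : AEMeasurable k) (hh : Measurable h) (hh' : ∫⁻ z, h z ≠ ⊤) :
    eLpNorm (fun x => ∫⁻ y, k (x - y) * h y) p ≤ eLpNorm k p * ∫⁻ z, h z := by
  have hfin : IsFiniteMeasure (volume.withDensity h) := isFiniteMeasure_withDensity hh'
  set k' := hk.mk k with hk'
  have hm : Measurable k' := hk.measurable_mk
  have hae : k =ᵐ[volume] k' := hk.ae_eq_mk
  have h0 : ∀ᵐ y ∂volume.withDensity h, eLpNorm (fun x => k' (x - y)) p ≤ eLpNorm k p :=
    Eventually.of_forall fun y => by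
      rw [eLpNorm_congr_ae hae]
      exact (eLpNorm_comp_of_measurePreserving hm (measurePreserving_sub_right volume y)).le
  have hm' : Measurable (Function.uncurry fun x y => k' (x - y)) :=
    hm.comp (measurable_fst.sub measurable_snd)
  have h1 := eLpNorm_lintegral_le (μ := volume) (ν := volume.withDensity h) hp hm' h0
  rw [withDensity_apply _ MeasurableSet.univ, Measure.restrict_univ] at h1
  refine le_trans (le_of_eq ?_) h1
  congr 1
  ext x
  rw [lintegral_withDensity_eq_lintegral_mul _ hh (g := fun y => k' (x - y))
    (hm.comp (measurable_const.sub measurable_id))]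
  have : ∀ᵐ y, k (x - y) = k' (x - y) :=
    (Measure.measurePreserving_sub_left volume x).quasiMeasurePreserving.ae hae
  refine lintegral_congr_ae ?_
  filter_upwards [this] with y hy
  simp [hy, mul_comm]

/-- Composition with an expanding map. -/
lemma eLpNorm_comp_le_of_antilipschitz {p : ℝ≥0∞} {K : NNReal} (hK : 1 ≤ K) {A : ℝ → ℝ}
    (hA : Measurable A) (hAK : AntilipschitzWith K A) (hp : 1 ≤ p) {h : ℝ → ℝ≥0∞}
    (hh : Measurable h) : eLpNorm (fun x => h (A x)) p ≤ K * eLpNorm h p := by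
  -- Lebesgue measure on the line is one-dimensional Hausdorff measure, and preimages under a
  -- K-antilipschitz map enlarge it at most K times. The norm then gains K^{1/p} ≤ K, as K ≥ 1.
  have h1 : Measure.map A volume ≤ (K : ℝ≥0∞) • (volume : Measure ℝ) := by
    refine Measure.le_iff.2 fun s hs => ?_
    have := hAK.hausdorffMeasure_preimage_le zero_le_one s
    rw [hausdorffMeasure_real, ENNReal.rpow_one] at this
    rw [Measure.map_apply hA hs, Measure.smul_apply, smul_eq_mul]
    exact this
  have h2 : eLpNorm (fun x => h (A x)) p = eLpNorm h p (Measure.map A volume) :=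
    (eLpNorm_map_measure hh.aestronglyMeasurable hA.aemeasurable).symm
  have h3 : (1 / p).toReal ≤ 1 := by
    rw [← ENNReal.toReal_one]
    refine ENNReal.toReal_mono ENNReal.one_ne_top ?_
    rw [one_div]; exact ENNReal.inv_le_one.2 hp
  have h4 : (K : ℝ≥0∞) ^ (1 / p).toReal ≤ K := by
    conv_rhs => rw [← ENNReal.rpow_one (K : ℝ≥0∞)]
    exact ENNReal.rpow_le_rpow_of_exponent_le (by exact_mod_cast hK) h3
  rw [h2]
  refine (eLpNorm_mono_measure _ h1).trans ((eLpNorm_smul_measure_le _ _ _ _).trans ?_)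
  rw [smul_eq_mul]
  exact mul_le_mul_left h4 _

end GCH
end

noncomputable section
namespace GCH
open MeasureTheory Set Filter Topology
open scoped ENNReal

/-! ### Weighted estimates -/

lemma eLpNorm_ofReal_abs (f : ℝ → ℝ) (p : ℝ≥0∞) :
    eLpNorm (fun x => ENNReal.ofReal |f x|) p = eLpNorm f p :=
  eLpNorm_congr_enorm_ae (Eventually.of_forall fun x => by
    simp [Real.enorm_eq_ofReal_abs])

/-- The non-negative function `θ` has a logarithm that is Lipschitz with constant `a`. -/
structure IsLogLipschitz (a : ℝ) (θ : ℝ → ℝ) : Prop where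
  cont : Continuous θ
  nonneg : ∀ x, 0 ≤ θ x
  le : ∀ x y, θ x ≤ Real.exp (a * |x - y|) * θ y

lemma lintegral_Icc_ofReal_exp_le {b t : ℝ} (hb : 0 < b) (ht : 0 ≤ t) :
    ∫⁻ τ in Icc 0 t, ENNReal.ofReal (Real.exp (b * τ)) ≤ ENNReal.ofReal (Real.exp (b * t) / b) := by
  have hc : Continuous fun τ : ℝ => Real.exp (b * τ) := by fun_prop
  rw [← ofReal_integral_eq_lintegral_ofReal
    (hc.continuousOn.integrableOn_compact isCompact_Icc)
    (Eventually.of_forall fun τ => (Real.exp_pos _).le), integral_Icc_eq_integral_Ioc,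
    ← intervalIntegral.integral_of_le ht]
  have : ∫ τ in (0 : ℝ)..t, Real.exp (b * τ) = Real.exp (b * t) / b - Real.exp (b * 0) / b := by
    refine intervalIntegral.integral_eq_sub_of_hasDerivAt
      (f := fun τ => Real.exp (b * τ) / b) (fun x _ => ?_) (hc.intervalIntegrable _ _)
    have := ((hasDerivAt_id x).const_mul b).exp.div_const b
    refine this.congr_deriv ?_
    field_simp
    simp
  rw [this]
  refine ENNReal.ofReal_le_ofReal ?_
  have : 0 < Real.exp (b * 0) / b := by positivity
  linarith

namespace IsReducedSolution
variable {T M : ℝ} {w wx : ℝ → ℝ → ℝ}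

/-- Joint continuity supplies the measurability needed for Minkowski's inequality. Time is projected
to [0, T] because characteristics are controlled only there. -/
lemma continuous_flow (h : IsReducedSolution T M w wx) {t : ℝ} (ht : t ∈ Icc 0 T) :
    Continuous fun z : ℝ × ℝ => flow T w t z.1 (projIcc 0 T h.pos.le z.2) := by
  refine continuous_iff_continuousAt.2 fun z₀ => ?_
  rw [ContinuousAt, tendsto_iff_dist_tendsto_zero]
  have h1 : Continuous fun z : ℝ × ℝ => Real.exp (2 * M * T) * |z.1 - z₀.1| +
      2 * M * |(projIcc 0 T h.pos.le z.2 : ℝ) - projIcc 0 T h.pos.le z₀.2| := by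
    have : Continuous fun z : ℝ × ℝ => (projIcc 0 T h.pos.le z.2 : ℝ) :=
      continuous_subtype_val.comp (continuous_projIcc.comp continuous_snd)
    fun_prop
  have h2 := h1.tendsto z₀
  simp only [sub_self, abs_zero, mul_zero, add_zero] at h2
  refine squeeze_zero (fun _ => dist_nonneg) (fun z => ?_) h2
  have a1 := h.isCharacteristic_dist_le (h.flow_spec ht z.1).2 (h.flow_spec ht z₀.1).2
    (τ := projIcc 0 T h.pos.le z.2) (σ := t) (projIcc 0 T h.pos.le z.2).2 ht
  rw [(h.flow_spec ht _).1, (h.flow_spec ht _).1] at a1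
  have a2 := h.abs_isCharacteristic_sub_le (h.flow_spec ht z₀.1).2
    (projIcc 0 T h.pos.le z.2).2 (projIcc 0 T h.pos.le z₀.2).2
  rw [Real.dist_eq]
  exact (_root_.abs_sub_le _ _ _).trans (add_le_add a1 a2)

lemma antilipschitz_flow (h : IsReducedSolution T M w wx) {t τ : ℝ} (ht : t ∈ Icc 0 T)
    (hτ : τ ∈ Icc 0 T) :
    AntilipschitzWith (Real.exp (2 * M * T)).toNNReal fun y => flow T w t y τ := by
  refine AntilipschitzWith.of_le_mul_dist fun y z => ?_
  have a1 := h.isCharacteristic_dist_le (h.flow_spec ht y).2 (h.flow_spec ht z).2 ht hτ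
  rw [(h.flow_spec ht _).1, (h.flow_spec ht _).1] at a1
  rw [Real.dist_eq, Real.dist_eq, Real.coe_toNNReal _ (Real.exp_pos _).le]
  exact a1

/-- Weighted norms of quantities controlled along the characteristics. -/
lemma eLpNorm_mul_le_of_flow (h : IsReducedSolution T M w wx) {p : ℝ≥0∞} (hp : 1 ≤ p)
    {a b K : ℝ} (ha : 0 ≤ a) (hb : 0 < b) (hK : 0 ≤ K) {θ : ℝ → ℝ} (hθ : IsLogLipschitz a θ)
    {S : ℝ → ℝ → ℝ} (hS : Continuous fun z : ℝ × ℝ => S z.1 z.2) (hS0 : ∀ t x, 0 ≤ S t x)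
    {m : ℝ≥0∞} (hm : ∀ τ ∈ Icc 0 T, eLpNorm (fun x => θ x * S τ x) p volume ≤
      m * ENNReal.ofReal (Real.exp (b * τ)))
    {t : ℝ} (ht : t ∈ Icc 0 T) {ω ω₀ : ℝ → ℝ} (hω₀ : Continuous ω₀)
    (hω : ∀ y, |ω y| ≤ K * (|ω₀ (flow T w t y 0)| + ∫ τ in 0..t, S τ (flow T w t y τ))) :
    eLpNorm (fun x => θ x * ω x) p volume ≤
      ENNReal.ofReal (K * Real.exp (2 * M * T * a) * Real.exp (2 * M * T)) *
        (eLpNorm (fun x => θ x * ω₀ x) p volume + m * ENNReal.ofReal (Real.exp (b * t) / b)) := by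
  have hM := h.bound_nonneg
  have hT := h.pos
  have h0 : (0 : ℝ) ∈ Icc 0 T := ⟨le_rfl, hT.le⟩
  set L : NNReal := (Real.exp (2 * M * T)).toNNReal with hL
  have hL1 : 1 ≤ L := by
    rw [hL, Real.one_le_toNNReal]; exact Real.one_le_exp (by positivity)
  set q : ℝ → ℝ → ℝ := fun y τ => flow T w t y (projIcc 0 T hT.le τ) with hq
  have hqc : Continuous fun z : ℝ × ℝ => q z.1 z.2 := h.continuous_flow ht
  have hqe : ∀ y, ∀ τ ∈ Icc 0 T, flow T w t y τ = q y τ := fun y τ hτ => by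
    simp only [hq, projIcc_of_mem hT.le hτ]
  have hqm : ∀ τ, Measurable fun y => q y τ := fun τ =>
    (hqc.comp (f := fun y : ℝ => (y, τ)) (by fun_prop)).measurable
  have hqa : ∀ τ, AntilipschitzWith L fun y => q y τ := fun τ =>
    h.antilipschitz_flow ht (projIcc 0 T hT.le τ).2
  -- A characteristic moves by at most 2MT, so the log-Lipschitz weight changes by at most e^{2MTa}.
  have hqθ : ∀ y τ, θ y ≤ Real.exp (2 * M * T * a) * θ (q y τ) := by
    intro y τ
    have hτ := (projIcc 0 T hT.le τ).2
    have a2 := h.abs_isCharacteristic_sub_le (h.flow_spec ht y).2 ht hτ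
    rw [(h.flow_spec ht _).1] at a2
    refine (hθ.le y (q y τ)).trans (mul_le_mul_of_nonneg_right (Real.exp_le_exp.2 ?_)
      (hθ.nonneg _))
    have : |t - (projIcc 0 T hT.le τ : ℝ)| ≤ T := by
      rw [abs_le]; constructor <;> linarith [ht.1, ht.2, hτ.1, hτ.2]
    calc a * |y - q y τ| ≤ a * (2 * M * T) :=
          mul_le_mul_of_nonneg_left (a2.trans (by gcongr)) ha
      _ = 2 * M * T * a := by ring
  have hqS : Continuous fun z : ℝ × ℝ => θ (q z.1 z.2) * S z.2 (q z.1 z.2) :=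
    (hθ.cont.comp hqc).mul (hS.comp (f := fun z : ℝ × ℝ => (z.2, q z.1 z.2)) (by fun_prop))
  have key : ∀ y, ENNReal.ofReal |θ y * ω y| ≤
      ENNReal.ofReal (K * Real.exp (2 * M * T * a)) * (ENNReal.ofReal |θ (q y 0) * ω₀ (q y 0)| +
        ∫⁻ τ in Icc 0 t, ENNReal.ofReal (θ (q y τ) * S τ (q y τ))) := by
    intro y
    have hc : Continuous fun τ => θ (q y τ) * S τ (q y τ) :=
      hqS.comp (f := fun τ : ℝ => (y, τ)) (by fun_prop)
    have hc' : Continuous fun τ => S τ (q y τ) :=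
      hS.comp (f := fun τ : ℝ => (τ, q y τ))
        (continuous_id.prodMk (hqc.comp (f := fun τ : ℝ => (y, τ)) (by fun_prop)))
    have hI : (∫ τ in 0..t, S τ (flow T w t y τ)) = ∫ τ in 0..t, S τ (q y τ) := by
      refine intervalIntegral.integral_congr fun τ hτ => ?_
      rw [uIcc_of_le ht.1] at hτ
      simp only [hqe y τ ⟨hτ.1, hτ.2.trans ht.2⟩]
    have h2 : θ y * ∫ τ in 0..t, S τ (q y τ) ≤
        Real.exp (2 * M * T * a) * ∫ τ in 0..t, θ (q y τ) * S τ (q y τ) := by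
      rw [← intervalIntegral.integral_const_mul, ← intervalIntegral.integral_const_mul]
      refine intervalIntegral.integral_mono_on ht.1
        ((continuous_const.mul hc').intervalIntegrable _ _)
        ((continuous_const.mul hc).intervalIntegrable _ _) fun τ _ => ?_
      rw [← mul_assoc]
      exact mul_le_mul_of_nonneg_right (hqθ y τ) (hS0 _ _)
    have hnn : ∀ τ, 0 ≤ θ (q y τ) * S τ (q y τ) := fun τ => mul_nonneg (hθ.nonneg _) (hS0 _ _)
    have h3 : (∫⁻ τ in Icc 0 t, ENNReal.ofReal (θ (q y τ) * S τ (q y τ))) =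
        ENNReal.ofReal (∫ τ in 0..t, θ (q y τ) * S τ (q y τ)) := by
      rw [intervalIntegral.integral_of_le ht.1, ← integral_Icc_eq_integral_Ioc,
        ofReal_integral_eq_lintegral_ofReal
        (hc.continuousOn.integrableOn_compact isCompact_Icc) (Eventually.of_forall hnn)]
    have hi0 : 0 ≤ ∫ τ in 0..t, θ (q y τ) * S τ (q y τ) :=
      intervalIntegral.integral_nonneg ht.1 fun τ _ => hnn τ
    rw [h3, ← ENNReal.ofReal_add (abs_nonneg _) hi0, ← ENNReal.ofReal_mul (by positivity)]
    refine ENNReal.ofReal_le_ofReal ?_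
    have h4 := hω y
    rw [hI, hqe y 0 h0] at h4
    rw [abs_mul, abs_mul, abs_of_nonneg (hθ.nonneg y), abs_of_nonneg (hθ.nonneg (q y 0))]
    calc θ y * |ω y| ≤ θ y * (K * (|ω₀ (q y 0)| + ∫ τ in 0..t, S τ (q y τ))) :=
          mul_le_mul_of_nonneg_left h4 (hθ.nonneg y)
      _ = K * (θ y * |ω₀ (q y 0)| + θ y * ∫ τ in 0..t, S τ (q y τ)) := by ring
      _ ≤ K * (Real.exp (2 * M * T * a) * θ (q y 0) * |ω₀ (q y 0)| +
            Real.exp (2 * M * T * a) * ∫ τ in 0..t, θ (q y τ) * S τ (q y τ)) := by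
          refine mul_le_mul_of_nonneg_left (add_le_add ?_ h2) hK
          exact mul_le_mul_of_nonneg_right (hqθ y 0) (abs_nonneg _)
      _ = _ := by ring
  have n1 : eLpNorm (fun y => ENNReal.ofReal |θ (q y 0) * ω₀ (q y 0)|) p volume ≤
      L * eLpNorm (fun x => θ x * ω₀ x) p volume := by
    rw [← eLpNorm_ofReal_abs (fun x => θ x * ω₀ x)]
    exact eLpNorm_comp_le_of_antilipschitz hL1 (hqm 0) (hqa 0) hp
      (h := fun x => ENNReal.ofReal |θ x * ω₀ x|)
      (ENNReal.continuous_ofReal.comp (hθ.cont.mul hω₀).abs).measurable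
  have n2 : eLpNorm (fun y => ∫⁻ τ in Icc 0 t, ENNReal.ofReal (θ (q y τ) * S τ (q y τ))) p volume ≤
      L * (m * ENNReal.ofReal (Real.exp (b * t) / b)) := by
    -- Dividing the source by e^{bτ} makes its norm bounded uniformly in τ, and the compensating
    -- measure e^{bτ}dτ on [0, t] has mass at most e^{bt}/b. The factor 1/b is the gain exploited in
    -- the Gronwall argument.
    set ν : Measure ℝ := (volume.restrict (Icc 0 t)).withDensity
      fun τ => ENNReal.ofReal (Real.exp (b * τ)) with hν
    have hdm : Measurable fun τ : ℝ => ENNReal.ofReal (Real.exp (b * τ)) := by fun_prop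
    have hνu : ν univ ≤ ENNReal.ofReal (Real.exp (b * t) / b) := by
      rw [hν, withDensity_apply _ MeasurableSet.univ, Measure.restrict_univ]
      exact lintegral_Icc_ofReal_exp_le hb ht.1
    have hfin : IsFiniteMeasure ν := ⟨hνu.trans_lt ENNReal.ofReal_lt_top⟩
    have hfm : Measurable (Function.uncurry fun y τ => ENNReal.ofReal (Real.exp (-(b * τ))) *
        ENNReal.ofReal (θ (q y τ) * S τ (q y τ))) := by
      have hm3 : Measurable fun z : ℝ × ℝ => ENNReal.ofReal (Real.exp (-(b * z.2))) := by fun_prop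
      exact hm3.mul (ENNReal.continuous_ofReal.comp hqS).measurable
    have hbd : ∀ᵐ τ ∂ν, eLpNorm (fun y => ENNReal.ofReal (Real.exp (-(b * τ))) *
        ENNReal.ofReal (θ (q y τ) * S τ (q y τ))) p volume ≤ L * m := by
      refine (withDensity_absolutelyContinuous _ _).ae_le ?_
      filter_upwards [ae_restrict_mem measurableSet_Icc] with τ hτ
      have hτ' : τ ∈ Icc 0 T := ⟨hτ.1, hτ.2.trans ht.2⟩
      have hSτ : Continuous (S τ) := hS.comp (f := fun x : ℝ => (τ, x)) (by fun_prop)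
      have e1 := eLpNorm_comp_le_of_antilipschitz hL1 (hqm τ) (hqa τ) hp
        (h := fun x => ENNReal.ofReal |θ x * S τ x|)
        (ENNReal.continuous_ofReal.comp (hθ.cont.mul hSτ).abs).measurable
      rw [eLpNorm_ofReal_abs (fun x => θ x * S τ x)] at e1
      have e2 : eLpNorm (fun y => ENNReal.ofReal (Real.exp (-(b * τ))) *
          ENNReal.ofReal (θ (q y τ) * S τ (q y τ))) p volume =
          ENNReal.ofReal (Real.exp (-(b * τ))) *
            eLpNorm (fun y => ENNReal.ofReal |θ (q y τ) * S τ (q y τ)|) p volume := by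
        rw [eLpNorm_ofReal_abs, ← Real.enorm_of_nonneg (Real.exp_pos _).le, ← eLpNorm_const_smul]
        refine eLpNorm_congr_enorm_ae (Eventually.of_forall fun y => ?_)
        simp only [enorm_eq_self, Pi.smul_apply, enorm_smul]
        rw [Real.enorm_of_nonneg (mul_nonneg (hθ.nonneg _) (hS0 _ _))]
      rw [e2]
      calc _ ≤ ENNReal.ofReal (Real.exp (-(b * τ))) *
            (L * (m * ENNReal.ofReal (Real.exp (b * τ)))) := by
            gcongr
            exact e1.trans (mul_le_mul_right (hm τ hτ') _)
        _ = L * m * (ENNReal.ofReal (Real.exp (-(b * τ))) * ENNReal.ofReal (Real.exp (b * τ))) := by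
            ring
        _ = L * m := by
            rw [← ENNReal.ofReal_mul (Real.exp_pos _).le, ← Real.exp_add]; simp
    have n := eLpNorm_lintegral_le (μ := volume) hp hfm hbd
    rw [← mul_assoc]
    refine le_trans (le_of_eq ?_) (n.trans (by gcongr))
    congr 1
    ext y
    have hm2 : Measurable fun τ => ENNReal.ofReal (Real.exp (-(b * τ))) *
        ENNReal.ofReal (θ (q y τ) * S τ (q y τ)) := hfm.comp measurable_prodMk_left
    rw [hν, lintegral_withDensity_eq_lintegral_mul _ hdm hm2]
    refine lintegral_congr fun τ => ?_
    simp only [Pi.mul_apply]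
    rw [← mul_assoc, ← ENNReal.ofReal_mul (Real.exp_pos _).le, ← Real.exp_add]
    simp
  have hm1 : AEStronglyMeasurable (fun y => ENNReal.ofReal |θ (q y 0) * ω₀ (q y 0)|) volume := by
    have : Continuous fun y => q y 0 := hqc.comp (f := fun y : ℝ => (y, 0)) (by fun_prop)
    exact (ENNReal.continuous_ofReal.comp
      ((hθ.cont.comp this).mul (hω₀.comp this)).abs).measurable.aestronglyMeasurable
  have hm2 : AEStronglyMeasurable
      (fun y => ∫⁻ τ in Icc 0 t, ENNReal.ofReal (θ (q y τ) * S τ (q y τ))) volume := by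
    have : Measurable (Function.uncurry fun y τ => ENNReal.ofReal (θ (q y τ) * S τ (q y τ))) :=
      (ENNReal.continuous_ofReal.comp hqS).measurable
    exact this.lintegral_prod_right'.aestronglyMeasurable
  rw [← eLpNorm_ofReal_abs (fun x => θ x * ω x)]
  set c : ℝ := K * Real.exp (2 * M * T * a) with hc
  have hc0 : 0 ≤ c := by positivity
  have hLc : (L : ℝ≥0∞) = ENNReal.ofReal (Real.exp (2 * M * T)) := rfl
  calc eLpNorm (fun x => ENNReal.ofReal |θ x * ω x|) p volume
      ≤ ENNReal.ofReal c * eLpNorm (fun y => ENNReal.ofReal |θ (q y 0) * ω₀ (q y 0)| +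
        ∫⁻ τ in Icc 0 t, ENNReal.ofReal (θ (q y τ) * S τ (q y τ))) p volume := by
        refine eLpNorm_le_mul_eLpNorm_of_ae_le_mul'' p (hm1.add hm2) ?_
        exact Eventually.of_forall fun y => by simpa only [enorm_eq_self, Pi.add_apply] using key y
    _ ≤ ENNReal.ofReal c * (L * eLpNorm (fun x => θ x * ω₀ x) p volume +
          L * (m * ENNReal.ofReal (Real.exp (b * t) / b))) := by
        gcongr
        exact (eLpNorm_add_le hm1 hm2 hp).trans (add_le_add n1 n2)
    _ = _ := by
        rw [ENNReal.ofReal_mul hc0, hLc]; ring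

end IsReducedSolution
end GCH
end

/-! ### Weighted bounds for the nonlocal operators -/

noncomputable section
namespace GCH
open MeasureTheory Set Filter Topology
open scoped ENNReal

lemma integrable_exp_neg_mul_abs {c : ℝ} (hc : 0 < c) :
    Integrable fun z : ℝ => Real.exp (-c * |z|) := by
  rw [← integrableOn_univ, ← Iic_union_Ioi (a := (0 : ℝ))]
  refine IntegrableOn.union ?_ ?_
  · refine (integrableOn_exp_mul_Iic hc 0).congr_fun (fun z hz => ?_) measurableSet_Iic
    simp only [abs_of_nonpos (mem_Iic.1 hz), neg_mul_neg]
  · refine (exp_neg_integrableOn_Ioi 0 hc).congr_fun (fun z hz => ?_) measurableSet_Ioi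
    simp only [abs_of_pos (mem_Ioi.1 hz)]

lemma integrable_exp_neg_abs_mul {c K : ℝ} (hc : 0 < c) {q : ℝ → ℝ} (hq : Continuous q)
    (hK : ∀ x, |q x| ≤ K) (x : ℝ) : Integrable fun z => Real.exp (-c * |z|) * q (x + z) := by
  refine Integrable.mul_bdd (c := K) ?_ (by fun_prop) (Eventually.of_forall fun z => hK _)
  exact integrable_exp_neg_mul_abs hc

lemma convGreen_eq_integral {K : ℝ} {q : ℝ → ℝ} (hq : Continuous q) (hK : ∀ x, |q x| ≤ K) (x : ℝ) :
    convGreen q x = ∫ z, Real.exp (-1 * |z|) * q (x + z) / 2 := by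
  have hI := integrable_exp_neg_abs_mul one_pos hq hK x
  have e1 : halfLineIntegral 1 q x = ∫ z in Ioi 0, Real.exp (-1 * |z|) * q (x + z) :=
    setIntegral_congr_fun measurableSet_Ioi fun z hz => by simp only [abs_of_pos (mem_Ioi.1 hz)]
  have e2 : halfLineIntegral 1 (fun y => q (-y)) (-x) =
      ∫ z in Iic 0, Real.exp (-1 * |z|) * q (x + z) := by
    have := integral_comp_neg_Ioi 0 fun z => Real.exp (-1 * |z|) * q (x + z)
    rw [neg_zero] at this
    rw [← this]
    refine setIntegral_congr_fun measurableSet_Ioi fun z hz => ?_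
    simp only [abs_neg, abs_of_pos (mem_Ioi.1 hz), neg_add, neg_neg]
  rw [convGreen, e1, e2, integral_div, ← intervalIntegral.integral_Iic_add_Ioi (b := 0)
    hI.integrableOn hI.integrableOn, add_comm]

lemma ofReal_convGreen {K : ℝ} {q : ℝ → ℝ} (hq : Continuous q) (hK : ∀ x, |q x| ≤ K)
    (hq0 : ∀ x, 0 ≤ q x) (x : ℝ) : ENNReal.ofReal (convGreen q x) =
      ∫⁻ z, ENNReal.ofReal (Real.exp (-1 * |z|) * q (x + z) / 2) := by
  rw [convGreen_eq_integral hq hK, ofReal_integral_eq_lintegral_ofReal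
    ((integrable_exp_neg_abs_mul one_pos hq hK x).div_const 2)
    (Eventually.of_forall fun z => ?_)]
  exact div_nonneg (mul_nonneg (Real.exp_pos _).le (hq0 _)) two_pos.le

lemma measurable_ofReal_abs {f : ℝ → ℝ} (hf : Continuous f) :
    Measurable fun x => ENNReal.ofReal |f x| :=
  (ENNReal.continuous_ofReal.comp hf.abs).measurable

/-- One factor |f| ≤ M is given up, the weight is moved inside the integral by `hkθ`, and Young's
inequality L¹ * L^p applies. The bound is linear in the weighted norm of f, as Gronwall requires. -/
lemma eLpNorm_mul_convGreen_sq_le {p : ℝ≥0∞} (hp : 1 ≤ p) {M : ℝ} {θ f k : ℝ → ℝ}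
    (hθ : Continuous θ) (hθ0 : ∀ x, 0 ≤ θ x) (hf : Continuous f) (hM : ∀ x, |f x| ≤ M)
    (hk : AEMeasurable k) (hk0 : ∀ x, 0 ≤ k x) (hkI : ∫⁻ z, ENNReal.ofReal (k z) ≠ ⊤)
    (hkθ : ∀ x z, θ x * Real.exp (-|z|) ≤ k z * θ (x + z)) :
    eLpNorm (fun x => θ x * convGreen (fun y => f y ^ 2) x) p volume ≤
      ENNReal.ofReal M * ((∫⁻ z, ENNReal.ofReal (k z)) * eLpNorm (fun x => θ x * f x) p volume) := by
  have hM0 : 0 ≤ M := (abs_nonneg _).trans (hM 0)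
  have hb : ∀ x, |f x ^ 2| ≤ M ^ 2 := fun x => by
    rw [abs_pow]; exact pow_le_pow_left₀ (abs_nonneg _) (hM x) 2
  have hY := eLpNorm_lintegral_mul_add_le hp (k := fun z => ENNReal.ofReal (k z))
    (h := fun x => ENNReal.ofReal |θ x * f x|) hk.ennreal_ofReal hkI
    (measurable_ofReal_abs (hθ.mul hf))
  rw [eLpNorm_ofReal_abs (fun x => θ x * f x)] at hY
  refine le_trans ?_ (mul_le_mul_right hY _)
  have hMe : ENNReal.ofReal M = (M.toNNReal : ℝ≥0∞) := rfl
  rw [hMe]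
  refine eLpNorm_le_mul_eLpNorm_of_ae_le_mul' (Eventually.of_forall fun x => ?_) p
  rw [← hMe, enorm_eq_self, Real.enorm_eq_ofReal_abs, abs_of_nonneg
    (mul_nonneg (hθ0 x) (convGreen_nonneg (fun y => sq_nonneg _) x)), ENNReal.ofReal_mul (hθ0 x),
    ofReal_convGreen (q := fun y => f y ^ 2) (hf.pow 2) hb (fun y => sq_nonneg _),
    ← lintegral_const_mul' _ _ ENNReal.ofReal_ne_top,
    ← lintegral_const_mul' _ _ ENNReal.ofReal_ne_top]
  refine lintegral_mono fun z => ?_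
  rw [← ENNReal.ofReal_mul (hθ0 x), ← ENNReal.ofReal_mul (hk0 z), ← ENNReal.ofReal_mul hM0]
  refine ENNReal.ofReal_le_ofReal ?_
  rw [abs_mul, abs_of_nonneg (hθ0 _), neg_one_mul, ← sq_abs (f _)]
  have h1 := hkθ x z
  have h2 := hM (x + z)
  have h3 : 0 ≤ θ x * Real.exp (-|z|) := mul_nonneg (hθ0 x) (Real.exp_pos _).le
  calc θ x * (Real.exp (-|z|) * |f (x + z)| ^ 2 / 2)
      = (θ x * Real.exp (-|z|)) * |f (x + z)| * (|f (x + z)| / 2) := by ring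
    _ ≤ (k z * θ (x + z)) * |f (x + z)| * M := by
        gcongr
        · exact mul_nonneg (mul_nonneg (hk0 z) (hθ0 _)) (abs_nonneg _)
        · linarith [abs_nonneg (f (x + z))]
    _ = _ := by ring

lemma eLpNorm_mul_halfLineIntegral_le {p : ℝ≥0∞} (hp : 1 ≤ p) {θ f k : ℝ → ℝ}
    (hθ : Continuous θ) (hθ0 : ∀ x, 0 ≤ θ x) (hf : Continuous f)
    (hk : AEMeasurable k) (hk0 : ∀ x, 0 ≤ k x) (hkI : ∫⁻ z, ENNReal.ofReal (k z) ≠ ⊤)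
    (hkθ : ∀ x z, θ x * Real.exp (-2 * |z|) ≤ k z * θ (x + z)) :
    eLpNorm (fun x => θ x * halfLineIntegral 2 f x) p volume ≤
      (∫⁻ z, ENNReal.ofReal (k z)) * eLpNorm (fun x => θ x * f x) p volume := by
  have hY := eLpNorm_lintegral_mul_add_le hp (k := fun z => ENNReal.ofReal (k z))
    (h := fun x => ENNReal.ofReal |θ x * f x|) hk.ennreal_ofReal hkI
    (measurable_ofReal_abs (hθ.mul hf))
  rw [eLpNorm_ofReal_abs (fun x => θ x * f x)] at hY
  refine le_trans (eLpNorm_mono_enorm fun x => ?_) hY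
  rw [enorm_eq_self, halfLineIntegral, ← integral_const_mul]
  refine (enorm_integral_le_lintegral_enorm _).trans ((setLIntegral_mono_ae' measurableSet_Ioi
    (g := fun z => ENNReal.ofReal (k z) * ENNReal.ofReal |θ (x + z) * f (x + z)|)
    (Eventually.of_forall fun z hz => ?_)).trans (setLIntegral_le_lintegral _ _))
  rw [Real.enorm_eq_ofReal_abs, ← ENNReal.ofReal_mul (hk0 z)]
  refine ENNReal.ofReal_le_ofReal ?_
  have h1 := hkθ x z
  rw [abs_of_pos (mem_Ioi.1 hz)] at h1
  rw [abs_mul, abs_mul, abs_mul, abs_of_nonneg (hθ0 _), abs_of_nonneg (hθ0 _), Real.abs_exp,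
    ← mul_assoc, ← mul_assoc]
  exact mul_le_mul_of_nonneg_right h1 (abs_nonneg _)

/-- The weight goes entirely onto f², giving k * (θ f²) with θ f² integrable by the L² bound.
Young's inequality L^p * L¹ then needs no integrability of k. -/
lemma eLpNorm_mul_convGreen_sq_le' {p : ℝ≥0∞} (hp : 1 ≤ p) {M : ℝ} {θ f k : ℝ → ℝ}
    (hθ : Continuous θ) (hθ0 : ∀ x, 0 ≤ θ x) (hf : Continuous f) (hM : ∀ x, |f x| ≤ M)
    (hk : AEMeasurable k) (hk0 : ∀ x, 0 ≤ k x)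
    (hkθ : ∀ x y, θ x * Real.exp (-|x - y|) ≤ k (x - y) * θ y)
    (hfin : eLpNorm (fun x => √(θ x) * f x) 2 volume ≠ ⊤) :
    eLpNorm (fun x => θ x * convGreen (fun y => f y ^ 2) x) p volume ≤
      eLpNorm k p volume * eLpNorm (fun x => √(θ x) * f x) 2 volume ^ 2 := by
  have hb : ∀ x, |f x ^ 2| ≤ M ^ 2 := fun x => by
    rw [abs_pow]; exact pow_le_pow_left₀ (abs_nonneg _) (hM x) 2
  have e : ∫⁻ z, ENNReal.ofReal (θ z * f z ^ 2) =
      eLpNorm (fun x => √(θ x) * f x) 2 volume ^ 2 := by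
    rw [eLpNorm_eq_lintegral_rpow_enorm_toReal two_ne_zero ENNReal.ofNat_ne_top,
      ENNReal.toReal_ofNat, ← ENNReal.rpow_natCast, ← ENNReal.rpow_mul]
    norm_num
    refine lintegral_congr fun z => ?_
    rw [← enorm_mul, ← enorm_pow, Real.enorm_of_nonneg (sq_nonneg _), mul_pow,
      Real.sq_sqrt (hθ0 z)]
  have hY := eLpNorm_lintegral_mul_sub_le hp (k := fun z => ENNReal.ofReal (k z))
    (h := fun x => ENNReal.ofReal (θ x * f x ^ 2)) hk.ennreal_ofReal
    (by fun_prop)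
    (by rw [e]; exact ENNReal.pow_ne_top hfin)
  have ek : eLpNorm (fun z => ENNReal.ofReal (k z)) p volume = eLpNorm k p volume :=
    eLpNorm_congr_enorm_ae (Eventually.of_forall fun z => by
      rw [enorm_eq_self, Real.enorm_of_nonneg (hk0 z)])
  rw [e, ek] at hY
  refine le_trans (eLpNorm_mono_enorm fun x => ?_) hY
  rw [enorm_eq_self, Real.enorm_of_nonneg
    (mul_nonneg (hθ0 x) (convGreen_nonneg (fun y => sq_nonneg _) x)), ENNReal.ofReal_mul (hθ0 x),
    ofReal_convGreen (q := fun y => f y ^ 2) (hf.pow 2) hb (fun y => sq_nonneg _),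
    ← lintegral_const_mul' _ _ ENNReal.ofReal_ne_top,
    ← lintegral_add_left_eq_self _ (-x)]
  refine lintegral_mono fun z => ?_
  rw [← ENNReal.ofReal_mul (hθ0 x), ← ENNReal.ofReal_mul (hk0 _)]
  refine ENNReal.ofReal_le_ofReal ?_
  have h1 := hkθ x z
  have h4 : |-x + z| = |x - z| := by rw [← abs_neg]; congr 1; ring
  have h3 : 0 ≤ θ x * Real.exp (-|x - z|) := mul_nonneg (hθ0 x) (Real.exp_pos _).le
  rw [neg_one_mul, h4, add_neg_cancel_left]
  calc θ x * (Real.exp (-|x - z|) * f z ^ 2 / 2)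
      = (θ x * Real.exp (-|x - z|)) * (f z ^ 2 / 2) := by ring
    _ ≤ (k (x - z) * θ z) * f z ^ 2 := by
        gcongr
        · exact mul_nonneg (hk0 _) (hθ0 _)
        · linarith [sq_nonneg (f z)]
    _ = _ := by ring

end GCH
end

/-! ### Gronwall argument and truncation of the weight -/

noncomputable section
namespace GCH
open MeasureTheory Set Filter Topology
open scoped ENNReal

lemma memLp_two_exp_neg_mul_abs {c : ℝ} (hc : 0 < c) :
    MemLp (fun x : ℝ => Real.exp (-c * |x|)) 2 := by
  rw [memLp_two_iff_integrable_sq (by fun_prop)]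
  refine (integrable_exp_neg_mul_abs (c := 2 * c) (by positivity)).congr
    (Eventually.of_forall fun x => ?_)
  simp only [← Real.exp_nat_mul]
  congr 1; push_cast; ring

lemma isLogLipschitz_min {a b : ℝ} (hab : b ≤ a) {θ₁ θ₂ : ℝ → ℝ} (h₁ : IsLogLipschitz a θ₁)
    (h₂ : IsLogLipschitz b θ₂) : IsLogLipschitz a fun x => min (θ₁ x) (θ₂ x) where
  cont := h₁.cont.min h₂.cont
  nonneg x := le_min (h₁.nonneg x) (h₂.nonneg x)
  le x y := by
    rw [mul_min_of_nonneg _ _ (Real.exp_pos _).le]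
    refine min_le_min (h₁.le x y) ((h₂.le x y).trans ?_)
    gcongr
    exact h₂.nonneg y

lemma isLogLipschitz_const_mul_exp {a n : ℝ} (ha : 0 ≤ a) (hn : 0 ≤ n) :
    IsLogLipschitz a fun x => n * Real.exp (-a * |x|) where
  cont := by fun_prop
  nonneg x := by positivity
  le x y := by
    rw [mul_left_comm, ← Real.exp_add]
    refine mul_le_mul_of_nonneg_left (Real.exp_le_exp.2 ?_) hn
    have := abs_sub_abs_le_abs_sub y x
    rw [abs_sub_comm] at this
    nlinarith

lemma le_two_mul_of_le_add_half {Y A : ℝ≥0∞} (hY : Y ≠ ⊤) (h : Y ≤ A + Y / 2) :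
    Y ≤ 2 * A := by
  have h2 : Y / 2 ≠ ⊤ := (ENNReal.div_lt_top hY two_ne_zero).ne
  have h3 : Y / 2 + Y / 2 ≤ A + Y / 2 := by rwa [ENNReal.add_halves]
  have h4 : Y / 2 ≤ A := (ENNReal.add_le_add_iff_right h2).1 h3
  calc Y = 2 * (Y / 2) := (ENNReal.mul_div_cancel two_ne_zero ENNReal.ofNat_ne_top).symm
    _ ≤ 2 * A := by gcongr

namespace IsReducedSolution
variable {T M : ℝ} {w wx : ℝ → ℝ → ℝ}

lemma continuous_slice (h : IsReducedSolution T M w wx) (t : ℝ) : Continuous (w t) :=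
  h.cont.comp (f := fun x : ℝ => (t, x)) (by fun_prop)

lemma continuous_slice_x (h : IsReducedSolution T M w wx) (t : ℝ) : Continuous (wx t) :=
  h.cont_x.comp (f := fun x : ℝ => (t, x)) (by fun_prop)

lemma convGreen_sq_nonneg (f : ℝ → ℝ) (x : ℝ) : 0 ≤ convGreen (fun y => f y ^ 2) x :=
  convGreen_nonneg (fun _ => sq_nonneg _) x

lemma eLpNorm_mul_le (h : IsReducedSolution T M w wx) {p : ℝ≥0∞} (hp : 1 ≤ p)
    {a b : ℝ} (ha : 0 ≤ a) (hb : 0 < b) {θ : ℝ → ℝ} (hθ : IsLogLipschitz a θ)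
    {m : ℝ≥0∞} (hm : ∀ τ ∈ Icc 0 T, eLpNorm (fun x => θ x * convGreen (fun y => w τ y ^ 2) x) p
      volume ≤ m * ENNReal.ofReal (Real.exp (b * τ))) {t : ℝ} (ht : t ∈ Icc 0 T) :
    eLpNorm (fun x => θ x * w t x) p volume ≤
      ENNReal.ofReal (Real.exp (2 * M * T * a) * Real.exp (2 * M * T)) *
        (eLpNorm (fun x => θ x * w 0 x) p volume +
          3 * m * ENNReal.ofReal (Real.exp (b * t) / b)) := by
  have := h.eLpNorm_mul_le_of_flow hp ha hb zero_le_one hθ (m := 3 * m)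
    (S := fun τ x => 3 * convGreen (fun y => w τ y ^ 2) x)
    (continuous_const.mul h.continuous_convGreen)
    (fun τ x => mul_nonneg (by norm_num) (convGreen_sq_nonneg _ x)) (fun τ hτ => ?_) ht
    (h.continuous_slice 0) (ω := w t) (fun y => ?_)
  · rwa [one_mul] at this
  · rw [mul_assoc]
    refine le_trans (eLpNorm_le_mul_eLpNorm_of_ae_le_mul' (c := 3) (Eventually.of_forall fun x => ?_)
      p) (mul_le_mul_right (hm τ hτ) _)
    rw [mul_left_comm, enorm_mul]
    gcongr
    rw [Real.enorm_of_nonneg (by norm_num)]; simp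
  · rw [one_mul]; exact h.abs_le_flow ht y

/-- Weighted bounds that do not see the weight: a Gronwall argument. -/
lemma exists_eLpNorm_mul_le (h : IsReducedSolution T M w wx) {p : ℝ≥0∞} (hp : 1 ≤ p)
    {a : ℝ} (ha : 0 ≤ a) {k : ℝ → ℝ} (hk : AEMeasurable k) (hk0 : ∀ x, 0 ≤ k x)
    (hkI : ∫⁻ z, ENNReal.ofReal (k z) ≠ ⊤) :
    ∃ C : ℝ≥0∞, C ≠ ⊤ ∧ ∀ θ : ℝ → ℝ, IsLogLipschitz a θ →
      (∀ x z, θ x * Real.exp (-|z|) ≤ k z * θ (x + z)) → ∀ B : ℝ≥0∞, B ≠ ⊤ →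
      (∀ t ∈ Icc 0 T, eLpNorm (fun x => θ x * w t x) p volume ≤ B) →
      ∀ t ∈ Icc 0 T, eLpNorm (fun x => θ x * w t x) p volume ≤
        C * eLpNorm (fun x => θ x * w 0 x) p volume := by
  have hM := h.bound_nonneg
  set c : ℝ := Real.exp (2 * M * T * a) * Real.exp (2 * M * T) with hc
  have hc0 : 0 < c := by positivity
  set I : ℝ := (∫⁻ z, ENNReal.ofReal (k z)).toReal with hI
  have hIe : ∫⁻ z, ENNReal.ofReal (k z) = ENNReal.ofReal I := (ENNReal.ofReal_toReal hkI).symm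
  have hI0 : 0 ≤ I := ENNReal.toReal_nonneg
  -- The Gronwall coefficient is 3cMI/b; this choice of b makes it at most 1/2, and the summand 1
  -- keeps b positive when M or I vanishes.
  set b : ℝ := 6 * c * M * I + 1 with hb
  have hb0 : 0 < b := by positivity
  refine ⟨ENNReal.ofReal (Real.exp (b * T)) * (2 * ENNReal.ofReal c), by finiteness, ?_⟩
  intro θ hθ hkθ B hB hBt
  set y : ℝ → ℝ≥0∞ := fun t => eLpNorm (fun x => θ x * w t x) p volume with hy
  -- The exponentially weighted supremum replaces Gronwall's lemma: no regularity of y in time is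
  -- needed. The a priori bound B serves only to make Y finite, so that Y/2 can be absorbed; it does
  -- not enter the constant.
  set Y : ℝ≥0∞ := ⨆ t ∈ Icc 0 T, y t * ENNReal.ofReal (Real.exp (-(b * t))) with hY
  have hYB : Y ≤ B := iSup₂_le fun t ht => by
    have : ENNReal.ofReal (Real.exp (-(b * t))) ≤ 1 := by
      rw [ENNReal.ofReal_le_one, Real.exp_le_one_iff]
      have := mul_nonneg hb0.le ht.1
      linarith
    calc y t * ENNReal.ofReal (Real.exp (-(b * t))) ≤ B * 1 := mul_le_mul' (hBt t ht) this
      _ = B := mul_one _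
  have hyY : ∀ t ∈ Icc 0 T, y t ≤ Y * ENNReal.ofReal (Real.exp (b * t)) := fun t ht => by
    have h1 : y t * ENNReal.ofReal (Real.exp (-(b * t))) ≤ Y :=
      le_iSup₂ (f := fun t (_ : t ∈ Icc 0 T) => y t * ENNReal.ofReal (Real.exp (-(b * t)))) t ht
    calc y t = y t * ENNReal.ofReal (Real.exp (-(b * t))) * ENNReal.ofReal (Real.exp (b * t)) := by
          rw [mul_assoc, ← ENNReal.ofReal_mul (Real.exp_pos _).le, ← Real.exp_add]; simp
      _ ≤ _ := by gcongr
  have hm : ∀ τ ∈ Icc 0 T, eLpNorm (fun x => θ x * convGreen (fun y => w τ y ^ 2) x) p volume ≤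
      ENNReal.ofReal (M * I) * Y * ENNReal.ofReal (Real.exp (b * τ)) := fun τ hτ => by
    refine (eLpNorm_mul_convGreen_sq_le hp hθ.cont hθ.nonneg (h.continuous_slice τ)
      (h.bound τ) hk hk0 hkI hkθ).trans ?_
    rw [hIe, ENNReal.ofReal_mul hM, mul_assoc, mul_assoc]
    gcongr
    exact hyY τ hτ
  have key : ∀ t ∈ Icc 0 T, y t * ENNReal.ofReal (Real.exp (-(b * t))) ≤
      ENNReal.ofReal c * y 0 + Y / 2 := fun t ht => by
    have h1 := h.eLpNorm_mul_le hp ha hb0 hθ hm ht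
    have h2 : ENNReal.ofReal (Real.exp (-(b * t))) ≤ 1 := by
      rw [ENNReal.ofReal_le_one, Real.exp_le_one_iff]
      have := mul_nonneg hb0.le ht.1
      linarith
    have h3 : ENNReal.ofReal c * (3 * (ENNReal.ofReal (M * I) * Y) *
        ENNReal.ofReal (Real.exp (b * t) / b)) * ENNReal.ofReal (Real.exp (-(b * t))) ≤ Y / 2 := by
      have e : ENNReal.ofReal c * (3 * (ENNReal.ofReal (M * I) * Y) *
        ENNReal.ofReal (Real.exp (b * t) / b)) * ENNReal.ofReal (Real.exp (-(b * t))) =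
        Y * ENNReal.ofReal (c * (3 * (M * I) * (Real.exp (b * t) / b)) * Real.exp (-(b * t))) := by
        have h5 : 0 ≤ 3 * (M * I) := by positivity
        have h4 : 0 ≤ 3 * (M * I) * (Real.exp (b * t) / b) :=
          mul_nonneg h5 (div_nonneg (Real.exp_pos _).le hb0.le)
        rw [ENNReal.ofReal_mul (mul_nonneg hc0.le h4), ENNReal.ofReal_mul hc0.le,
          ENNReal.ofReal_mul h5, ENNReal.ofReal_mul zero_le_three, ENNReal.ofReal_ofNat]
        ring
      rw [e, div_eq_mul_inv Y 2]
      gcongr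
      rw [show (2 : ℝ≥0∞)⁻¹ = ENNReal.ofReal (2⁻¹) by
        rw [ENNReal.ofReal_inv_of_pos two_pos, ENNReal.ofReal_ofNat]]
      refine ENNReal.ofReal_le_ofReal ?_
      have : c * (3 * (M * I) * (Real.exp (b * t) / b)) * Real.exp (-(b * t)) =
          3 * c * M * I / b := by
        rw [Real.exp_neg]; field_simp
      rw [this, div_le_iff₀ hb0, hb]
      linarith
    calc y t * ENNReal.ofReal (Real.exp (-(b * t)))
        ≤ ENNReal.ofReal c * (y 0 + 3 * (ENNReal.ofReal (M * I) * Y) *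
          ENNReal.ofReal (Real.exp (b * t) / b)) * ENNReal.ofReal (Real.exp (-(b * t))) := by
          gcongr
      _ = ENNReal.ofReal c * y 0 * ENNReal.ofReal (Real.exp (-(b * t))) +
          ENNReal.ofReal c * (3 * (ENNReal.ofReal (M * I) * Y) *
          ENNReal.ofReal (Real.exp (b * t) / b)) * ENNReal.ofReal (Real.exp (-(b * t))) := by ring
      _ ≤ ENNReal.ofReal c * y 0 * 1 + Y / 2 := by gcongr
      _ = _ := by rw [mul_one]
  have hY2 : Y ≤ 2 * (ENNReal.ofReal c * y 0) :=
    le_two_mul_of_le_add_half (ne_top_of_le_ne_top hB hYB) (iSup₂_le key)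
  intro t ht
  calc y t ≤ Y * ENNReal.ofReal (Real.exp (b * t)) := hyY t ht
    _ ≤ 2 * (ENNReal.ofReal c * y 0) * ENNReal.ofReal (Real.exp (b * T)) := by
        gcongr
        exact ht.2
    _ = _ := by ring

/-- The `L²` estimate with a weight `θ`, by truncation of the weight. -/
lemma exists_eLpNorm_two_mul_le (h : IsReducedSolution T M w wx) {a : ℝ} (ha : 1 / 4 ≤ a)
    {k : ℝ → ℝ} (hk : AEMeasurable k) (hk0 : ∀ x, Real.exp (-(|x| / 2)) ≤ k x)
    (hkI : ∫⁻ z, ENNReal.ofReal (k z) ≠ ⊤) {θ : ℝ → ℝ} (hθ : IsLogLipschitz a θ)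
    (hkθ : ∀ x z, θ x * Real.exp (-|z|) ≤ k z * θ (x + z)) :
    ∃ C : ℝ≥0∞, C ≠ ⊤ ∧ ∀ t ∈ Icc 0 T, eLpNorm (fun x => θ x * w t x) 2 volume ≤
        C * eLpNorm (fun x => θ x * w 0 x) 2 volume := by
  have hk0' : ∀ x, 0 ≤ k x := fun x => (Real.exp_pos _).le.trans (hk0 x)
  obtain ⟨C, hC, hCθ⟩ := h.exists_eLpNorm_mul_le (p := 2) one_le_two (by linarith : 0 ≤ a) hk hk0' hkI
  refine ⟨C, hC, fun t ht => ?_⟩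
  -- The cut-off n e^{-|x|/4} is square integrable, so |w| ≤ M makes the truncated norms finite. Its
  -- decay rate 1/4 is slow enough for both structural conditions to hold with the same a and k: 1/4
  -- ≤ a, and e^{-|x|/4 - |z|} ≤ e^{-|z|/2} e^{-|x+z|/4}.
  set θn : ℕ → ℝ → ℝ := fun n x => min (θ x) (n * Real.exp (-(1 / 4) * |x|)) with hθn
  have hn0 : ∀ n x, 0 ≤ θn n x := fun n x => le_min (hθ.nonneg x) (by positivity)
  have hn : ∀ n, eLpNorm (fun x => θn n x * w t x) 2 volume ≤
      C * eLpNorm (fun x => θ x * w 0 x) 2 volume := by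
    intro n
    have hlog : IsLogLipschitz a (θn n) :=
      isLogLipschitz_min ha hθ (isLogLipschitz_const_mul_exp (by norm_num) n.cast_nonneg)
    have hker : ∀ x z, θn n x * Real.exp (-|z|) ≤ k z * θn n (x + z) := by
      intro x z
      simp only [hθn]
      rw [mul_min_of_nonneg _ _ (hk0' z), min_mul_of_nonneg _ _ (Real.exp_pos _).le]
      refine min_le_min (hkθ x z) ?_
      calc n * Real.exp (-(1 / 4) * |x|) * Real.exp (-|z|)
          = n * Real.exp (-(1 / 4) * |x| + -|z|) := by rw [mul_assoc, Real.exp_add]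
        _ ≤ n * Real.exp (-(|z| / 2) + -(1 / 4) * |x + z|) := by
            refine mul_le_mul_of_nonneg_left (Real.exp_le_exp.2 ?_) n.cast_nonneg
            have := abs_add_le x z
            have := abs_nonneg z
            linarith
        _ = Real.exp (-(|z| / 2)) * (n * Real.exp (-(1 / 4) * |x + z|)) := by
            rw [Real.exp_add]; ring
        _ ≤ _ := by gcongr; exact hk0 z
    have hmem := (memLp_two_exp_neg_mul_abs (c := 1 / 4) (by norm_num)).eLpNorm_ne_top
    refine (hCθ (θn n) hlog hker (‖(n * M : ℝ)‖₊ *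
      eLpNorm (fun x : ℝ => Real.exp (-(1 / 4) * |x|)) 2 volume) (by finiteness) ?_ t ht).trans ?_
    · intro τ _
      refine eLpNorm_le_mul_eLpNorm_of_ae_le_mul' (Eventually.of_forall fun x => ?_) 2
      rw [← enorm_eq_nnnorm, ← enorm_mul, Real.enorm_eq_ofReal_abs, Real.enorm_eq_ofReal_abs]
      refine ENNReal.ofReal_le_ofReal ?_
      rw [abs_mul, abs_of_nonneg (hn0 n x)]
      calc θn n x * |w τ x| ≤ (n * Real.exp (-(1 / 4) * |x|)) * M :=
            mul_le_mul (min_le_right _ _) (h.bound τ x) (abs_nonneg _) (by positivity)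
        _ = n * M * Real.exp (-(1 / 4) * |x|) := by ring
        _ ≤ _ := le_abs_self _
    · refine mul_le_mul_right (eLpNorm_mono_enorm fun x => ?_) _
      rw [enorm_mul, enorm_mul, Real.enorm_of_nonneg (hn0 n x), Real.enorm_of_nonneg (hθ.nonneg x)]
      gcongr
      exact min_le_left _ _
  -- Fatou: at each point the truncated weights are eventually equal to θ, and the bound is uniform
  -- in n.
  have hlim := Lp.eLpNorm_lim_le_liminf_eLpNorm (p := 2) (μ := volume)
    (f := fun (n : ℕ) x => θn n x * w t x) (fun n => ?_) (fun x => θ x * w t x)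
    (Eventually.of_forall fun x => ?_)
  · refine hlim.trans (le_trans (liminf_le_liminf (Eventually.of_forall hn)) ?_)
    rw [liminf_const]
  · have hc : Continuous (θn n) := hθ.cont.min (by fun_prop)
    exact (hc.mul (h.continuous_slice t)).aestronglyMeasurable
  · refine tendsto_const_nhds.congr' ?_
    obtain ⟨N, hN⟩ := exists_nat_ge (θ x / Real.exp (-(1 / 4) * |x|))
    filter_upwards [eventually_ge_atTop N] with n hn
    have : θ x ≤ n * Real.exp (-(1 / 4) * |x|) := by
      rw [← div_le_iff₀ (Real.exp_pos _)]
      exact hN.trans (by exact_mod_cast hn)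
    simp only [hθn, min_eq_left this]

/-- Bounds for `w` and `w_x` from a bound for the nonlocal term. -/
lemma exists_eLpNorm_bound (h : IsReducedSolution T M w wx) {p : ℝ≥0∞} (hp : 1 ≤ p)
    {a : ℝ} (ha : 0 ≤ a) {θ : ℝ → ℝ} (hθ : IsLogLipschitz a θ) {m : ℝ≥0∞} (hm' : m ≠ ⊤)
    (hm : ∀ τ ∈ Icc 0 T, eLpNorm (fun x => θ x * convGreen (fun y => w τ y ^ 2) x) p volume ≤ m)
    (h0 : eLpNorm (fun x => θ x * w 0 x) p volume ≠ ⊤)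
    (h0x : eLpNorm (fun x => θ x * wx 0 x) p volume ≠ ⊤) :
    ∃ B : ℝ≥0∞, B ≠ ⊤ ∧ ∀ t ∈ Icc 0 T, eLpNorm (fun x => θ x * w t x) p volume ≤ B ∧
      eLpNorm (fun x => θ x * wx t x) p volume ≤ B := by
  have hM := h.bound_nonneg
  have hexp : ∀ m : ℝ≥0∞, ∀ τ ∈ Icc 0 T, m ≤ m * ENNReal.ofReal (Real.exp (1 * τ)) := by
    intro m τ hτ
    refine le_mul_of_one_le_right' ?_
    rw [ENNReal.one_le_ofReal]
    exact Real.one_le_exp (by rw [one_mul]; exact hτ.1)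
  have hT' : ∀ t ∈ Icc 0 T, Real.exp (1 * t) / 1 ≤ Real.exp T :=
    fun t ht => by
      rw [one_mul, div_one]; exact Real.exp_le_exp.2 ht.2
  set B₁ : ℝ≥0∞ := ENNReal.ofReal (Real.exp (2 * M * T * a) * Real.exp (2 * M * T)) *
        (eLpNorm (fun x => θ x * w 0 x) p volume + 3 * m * ENNReal.ofReal (Real.exp T)) with hB₁
  have hB₁' : B₁ ≠ ⊤ := by finiteness
  have h1 : ∀ t ∈ Icc 0 T, eLpNorm (fun x => θ x * w t x) p volume ≤ B₁ := fun t ht => by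
    refine (h.eLpNorm_mul_le hp ha one_pos hθ (fun τ hτ => (hm τ hτ).trans (hexp m τ hτ)) ht).trans ?_
    rw [hB₁]
    gcongr
    exact hT' t ht
  -- The source for w_x contains the local term w², whose weighted norm is at most M times that of
  -- w, already bounded by B₁.
  set m₂ : ℝ≥0∞ := 3 * (m + ENNReal.ofReal M * B₁) with hm₂
  set B₂ : ℝ≥0∞ := ENNReal.ofReal (Real.exp (2 * M * T) * Real.exp (2 * M * T * a) *
    Real.exp (2 * M * T)) * (eLpNorm (fun x => θ x * wx 0 x) p volume +
      m₂ * ENNReal.ofReal (Real.exp T)) with hB₂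
  have hB₂' : B₂ ≠ ⊤ := by finiteness
  refine ⟨max B₁ B₂, by finiteness, fun t ht => ⟨(h1 t ht).trans (le_max_left _ _),
    le_trans ?_ (le_max_right _ _)⟩⟩
  have hS : ∀ τ ∈ Icc 0 T, eLpNorm (fun x => θ x *
      (3 * (convGreen (fun y => w τ y ^ 2) x + w τ x ^ 2))) p volume ≤ m₂ := fun τ hτ => by
    have c1 : Continuous fun x => convGreen (fun y => w τ y ^ 2) x :=
      h.continuous_convGreen.comp (f := fun x : ℝ => (τ, x)) (by fun_prop)
    have c2 := h.continuous_slice τ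
    have e1 : eLpNorm (fun x => θ x * (3 * (convGreen (fun y => w τ y ^ 2) x + w τ x ^ 2))) p
        volume ≤ (3 : NNReal) * eLpNorm ((fun x => θ x * convGreen (fun y => w τ y ^ 2) x) +
          fun x => θ x * w τ x ^ 2) p volume := by
      refine eLpNorm_le_mul_eLpNorm_of_ae_le_mul' (Eventually.of_forall fun x => ?_) p
      rw [mul_left_comm, enorm_mul, Pi.add_apply, ← mul_add]
      gcongr
      rw [Real.enorm_of_nonneg (by norm_num)]; simp
    refine e1.trans ?_
    rw [hm₂]
    refine mul_le_mul' le_rfl ((eLpNorm_add_le (hθ.cont.mul c1).aestronglyMeasurable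
      (hθ.cont.mul (c2.pow 2)).aestronglyMeasurable hp).trans (add_le_add (hm τ hτ) ?_))
    refine le_trans ?_ (mul_le_mul_right (h1 τ hτ) _)
    refine eLpNorm_le_mul_eLpNorm_of_ae_le_mul' (c := M.toNNReal)
      (Eventually.of_forall fun x => ?_) p
    have e2 : θ x * w τ x ^ 2 = w τ x * (θ x * w τ x) := by ring
    change ‖θ x * w τ x ^ 2‖ₑ ≤ _
    rw [e2, enorm_mul, Real.enorm_eq_ofReal_abs (w τ x)]
    exact mul_le_mul' (ENNReal.ofReal_le_ofReal (h.bound τ x)) le_rfl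
  refine (h.eLpNorm_mul_le_of_flow hp ha one_pos (Real.exp_pos (2 * M * T)).le hθ (m := m₂)
    (S := fun τ x => 3 * (convGreen (fun y => w τ y ^ 2) x + w τ x ^ 2))
    (continuous_const.mul (h.continuous_convGreen.add (h.cont.pow 2)))
    (fun τ x => mul_nonneg (by norm_num) (add_nonneg (convGreen_sq_nonneg _ x) (sq_nonneg _)))
    (fun τ hτ => (hS τ hτ).trans (hexp m₂ τ hτ)) ht (h.continuous_slice_x 0) (ω := wx t)
    (fun y => h.abs_deriv_le_flow ht y)).trans ?_
  rw [hB₂]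
  gcongr
  exact hT' t ht

end IsReducedSolution
end GCH
end

/-! ### Properties of the weight and the dominating kernel -/

noncomputable section
namespace GCH
open MeasureTheory Set Filter Topology
open scoped ENNReal

lemma LocallyAbsolutelyContinuous.continuous {φ : ℝ → ℝ} (h : LocallyAbsolutelyContinuous φ) :
    Continuous φ := by
  refine continuous_iff_continuousAt.2 fun x => ?_
  refine (h (x - 1) (x + 1)).continuousOn.continuousAt ?_
  rw [uIcc_of_le (by linarith)]
  exact Icc_mem_nhds (by linarith) (by linarith)

lemma LocallyAbsolutelyContinuous.integral_exp_mul {φ : ℝ → ℝ} (h : LocallyAbsolutelyContinuous φ)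
    (c x y : ℝ) : ∫ z in x..y, (deriv φ z + c * φ z) * Real.exp (c * z) =
      φ y * Real.exp (c * y) - φ x * Real.exp (c * x) := by
  have hd : ∀ z : ℝ, HasDerivAt (fun z => Real.exp (c * z)) (c * Real.exp (c * z)) z := fun z => by
    have := ((hasDerivAt_id z).const_mul c).exp
    exact this.congr_deriv (by simp [mul_comm])
  have hg : AbsolutelyContinuousOnInterval (fun z => Real.exp (c * z)) x y :=
    ContDiffOn.absolutelyContinuousOnInterval (by fun_prop)
  rw [← (h x y).integral_deriv_mul_eq_sub hg]
  refine intervalIntegral.integral_congr fun z _ => ?_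
  simp only [(hd z).deriv]
  ring

lemma IsFastGrowingWeight.exists_isLogLipschitz {p : ℝ≥0∞} {v φ : ℝ → ℝ}
    (h : IsFastGrowingWeight p v φ) : ∃ A, 1 ≤ A ∧ IsLogLipschitz A φ := by
  obtain ⟨A₀, -, hA₀⟩ := h.deriv_le
  have hpos := h.moderate.pos
  -- Raising the constant to at least 1 secures the lower bound 1/4 required by the truncation.
  set A := max A₀ 1 with hA'
  have hA : ∀ᵐ x, |deriv φ x| ≤ A * φ x := by
    filter_upwards [hA₀] with x hx
    rw [abs_of_pos (hpos x)] at hx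
    exact hx.trans (mul_le_mul_of_nonneg_right (le_max_left _ _) (hpos x).le)
  -- Absolute continuity turns the a.e. inequality φ' + Aφ ≥ 0 into monotonicity of φ e^{Ax};
  -- similarly φ e^{-Ax} is nonincreasing.
  have up : ∀ x y, x ≤ y → φ x ≤ Real.exp (A * (y - x)) * φ y := fun x y hxy => by
    have h1 := h.locallyAbsolutelyContinuous.integral_exp_mul A x y
    have h2 : 0 ≤ ∫ z in x..y, (deriv φ z + A * φ z) * Real.exp (A * z) := by
      refine intervalIntegral.integral_nonneg_of_ae hxy ?_
      filter_upwards [hA] with z hz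
      have := (abs_le.1 hz).1
      exact mul_nonneg (by linarith) (Real.exp_pos _).le
    have h3 : φ x * Real.exp (A * x) ≤ φ y * Real.exp (A * y) := by linarith
    rw [← le_div_iff₀ (Real.exp_pos _)] at h3
    refine h3.trans (le_of_eq ?_)
    rw [mul_sub, Real.exp_sub]; ring
  have down : ∀ x y, x ≤ y → φ y ≤ Real.exp (A * (y - x)) * φ x := fun x y hxy => by
    have h1 := h.locallyAbsolutelyContinuous.integral_exp_mul (-A) x y
    have h2 : 0 ≤ ∫ z in x..y, -((deriv φ z + -A * φ z) * Real.exp (-A * z)) := by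
      refine intervalIntegral.integral_nonneg_of_ae hxy ?_
      filter_upwards [hA] with z hz
      have := (abs_le.1 hz).2
      rw [Pi.zero_apply, ← neg_mul]
      exact mul_nonneg (by linarith) (Real.exp_pos _).le
    rw [intervalIntegral.integral_neg] at h2
    have h3 : φ y * Real.exp (-A * y) ≤ φ x * Real.exp (-A * x) := by linarith
    rw [← le_div_iff₀ (Real.exp_pos _)] at h3
    refine h3.trans (le_of_eq ?_)
    rw [mul_sub, Real.exp_sub, neg_mul, neg_mul, Real.exp_neg, Real.exp_neg]
    field_simp
  refine ⟨A, le_max_right _ _, h.locallyAbsolutelyContinuous.continuous, fun x => (hpos x).le,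
    fun x y => ?_⟩
  rcases le_total x y with hxy | hxy
  · rw [abs_sub_comm, abs_of_nonneg (sub_nonneg.2 hxy)]; exact up x y hxy
  · rw [abs_of_nonneg (sub_nonneg.2 hxy)]; exact down y x hxy

lemma IsLogLipschitz.sqrt {a : ℝ} (ha : 0 ≤ a) {θ : ℝ → ℝ} (h : IsLogLipschitz a θ) :
    IsLogLipschitz a fun x => √(θ x) where
  cont := h.cont.sqrt
  nonneg x := Real.sqrt_nonneg _
  le x y := by
    have h1 : 1 ≤ Real.exp (a * |x - y|) := Real.one_le_exp (by positivity)
    calc √(θ x) ≤ √(Real.exp (a * |x - y|) * θ y) := Real.sqrt_le_sqrt (h.le x y)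
      _ = √(Real.exp (a * |x - y|)) * √(θ y) := Real.sqrt_mul (Real.exp_pos _).le _
      _ ≤ _ := by
        refine mul_le_mul_of_nonneg_right ?_ (Real.sqrt_nonneg _)
        rw [Real.sqrt_le_left (Real.exp_pos _).le]
        nlinarith

/-- The measure e^{-c|x|}dx is finite and at most dx, so L^p(dx) embeds in its L¹. -/
lemma integrable_mul_exp_neg_mul_abs {p : ℝ≥0∞} (hp : 1 ≤ p) {f : ℝ → ℝ} (hf : MemLp f p)
    {c : ℝ} (hc : 0 < c) : Integrable fun x => f x * Real.exp (-c * |x|) := by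
  have hI := integrable_exp_neg_mul_abs hc
  have hm : Measurable fun x : ℝ => (Real.exp (-c * |x|)).toNNReal := by fun_prop
  set μ : Measure ℝ := volume.withDensity fun x => ((Real.exp (-c * |x|)).toNNReal : ℝ≥0∞) with hμ
  have hfin : IsFiniteMeasure μ := by
    refine isFiniteMeasure_withDensity ?_
    exact hI.lintegral_lt_top.ne
  have hle : μ ≤ volume := by
    calc μ ≤ volume.withDensity 1 := withDensity_mono (Eventually.of_forall fun x => by
          simp only [Pi.one_apply, ENNReal.coe_le_one_iff, Real.toNNReal_le_one,
            Real.exp_le_one_iff]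
          have := mul_nonneg hc.le (abs_nonneg x)
          linarith)
      _ = volume := withDensity_one
  have h1 : Integrable f μ := ((hf.mono_measure hle).mono_exponent hp).integrable le_rfl
  rw [hμ, integrable_withDensity_iff_integrable_coe_smul hm] at h1
  refine h1.congr (Eventually.of_forall fun x => ?_)
  simp only [Real.coe_toNNReal _ (Real.exp_pos _).le, smul_eq_mul, mul_comm]

/-- The integrable kernel that dominates all the convolutions. -/
def weightKernel (C : ℝ) (v : ℝ → ℝ) (z : ℝ) : ℝ :=
  C * v (-z) * Real.exp (-(3 / 2) * |z|) + Real.exp (-(1 / 2) * |z|)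

section weightKernel
variable {p : ℝ≥0∞} {v : ℝ → ℝ} {C : ℝ}

lemma integrable_weightKernel (hp : 1 ≤ p) (hv : MemLp (fun x => v x * Real.exp (-|x|)) p) :
    Integrable (weightKernel C v) := by
  have h1 := (integrable_mul_exp_neg_mul_abs hp hv (c := 1 / 2) (by norm_num)).comp_neg
  refine ((h1.const_mul C).add
    (integrable_exp_neg_mul_abs (c := 1 / 2) (by norm_num))).congr (Eventually.of_forall fun z => ?_)
  simp only [weightKernel, Pi.add_apply, abs_neg, mul_assoc, ← Real.exp_add]
  congr 4
  ring

lemma exp_le_weightKernel (hC : 0 ≤ C) (hv : ∀ x, 0 ≤ v x) (z : ℝ) :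
    Real.exp (-(|z| / 2)) ≤ weightKernel C v z := by
  have : 0 ≤ C * v (-z) * Real.exp (-(3 / 2) * |z|) :=
    mul_nonneg (mul_nonneg hC (hv _)) (Real.exp_pos _).le
  have e : -(|z| / 2) = -(1 / 2) * |z| := by ring
  rw [weightKernel, e]; linarith

lemma mul_exp_le_weightKernel (hC : 0 ≤ C) (hv : ∀ x, 0 ≤ v x) (z : ℝ) :
    C * v (-z) * Real.exp (-2 * |z|) ≤ weightKernel C v z := by
  have h1 : C * v (-z) * Real.exp (-2 * |z|) ≤ C * v (-z) * Real.exp (-(3 / 2) * |z|) := by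
    refine mul_le_mul_of_nonneg_left (Real.exp_le_exp.2 ?_) (mul_nonneg hC (hv _))
    have := abs_nonneg z
    linarith
  have := Real.exp_pos (-(1 / 2) * |z|)
  rw [weightKernel]; linarith

/-- Split e^{-|z|} as e^{-3|z|/4} e^{-|z|/4} and apply the arithmetic-geometric mean inequality to
√(Cv(-z)) e^{-3|z|/4} and e^{-|z|/4}; the two squares are the summands of the kernel. -/
lemma sqrt_mul_exp_le_weightKernel (hC : 0 ≤ C) (hv : ∀ x, 0 ≤ v x) (z : ℝ) :
    √(C * v (-z)) * Real.exp (-|z|) ≤ weightKernel C v z := by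
  have hs := Real.sq_sqrt (mul_nonneg hC (hv (-z)))
  set r := √(C * v (-z)) with hr
  set e := Real.exp (-(1 / 4) * |z|) with he
  have e1 : Real.exp (-|z|) = e ^ 4 := by rw [he, ← Real.exp_nat_mul]; congr 1; push_cast; ring
  have e2 : Real.exp (-(3 / 2) * |z|) = e ^ 6 := by
    rw [he, ← Real.exp_nat_mul]; congr 1; push_cast; ring
  have e3 : Real.exp (-(1 / 2) * |z|) = e ^ 2 := by
    rw [he, ← Real.exp_nat_mul]; congr 1; push_cast; ring
  rw [weightKernel, ← hs, e1, e2, e3]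
  nlinarith [sq_nonneg (r * e ^ 3 - e), sq_nonneg (r * e ^ 3), sq_nonneg e]

end weightKernel

end GCH
end

/-! ### Weighted bounds for w and recovery of u -/

noncomputable section
namespace GCH
open MeasureTheory Set Filter Topology
open scoped ENNReal

/-- `w θ`, `w_x θ` and `((2 - ∂ₓ)⁻¹ w) θ` are bounded in `L^p` by `B`. -/
def WeightedBound (p B : ℝ≥0∞) (θ w wx : ℝ → ℝ) : Prop :=
  eLpNorm (fun x => θ x * w x) p volume ≤ B ∧ eLpNorm (fun x => θ x * wx x) p volume ≤ B ∧
    eLpNorm (fun x => θ x * halfLineIntegral 2 w x) p volume ≤ B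

lemma eLpNorm_two_mul_sub_le {p B₁ B₂ : ℝ≥0∞} (hp : 1 ≤ p) {f g : ℝ → ℝ} (hf : Continuous f)
    (hg : Continuous g) (h₁ : eLpNorm f p volume ≤ B₁) (h₂ : eLpNorm g p volume ≤ B₂) :
    eLpNorm (fun x => 2 * f x - g x) p volume ≤ 2 * B₁ + B₂ := by
  have h3 : eLpNorm (fun x => 2 * f x) p volume ≤ 2 * B₁ := by
    refine (eLpNorm_le_mul_eLpNorm_of_ae_le_mul' (c := 2) (Eventually.of_forall fun x => ?_) p).trans
      (mul_le_mul_right h₁ _)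
    rw [enorm_mul, Real.enorm_of_nonneg zero_le_two]; simp
  exact (eLpNorm_sub_le (continuous_const.mul hf).aestronglyMeasurable hg.aestronglyMeasurable
    hp).trans (add_le_add h3 h₂)

lemma WeightedBound.weightedNorm_le {p B : ℝ≥0∞} (hp : 1 ≤ p) {θ u w wx : ℝ → ℝ}
    (h : WeightedBound p B θ w wx) (hθ : Continuous θ) (hwx : Continuous wx)
    (hw : ∀ x, HasDerivAt w (wx x) x) (hu : ∀ x, HasDerivAt u (2 * u x - w x) x)
    (huw : ∀ x, u x = halfLineIntegral 2 w x) : weightedNorm p θ u ≤ 11 * B := by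
  obtain ⟨h1, h2, h3⟩ := h
  have hwc : Continuous w := continuous_iff_continuousAt.2 fun x => (hw x).continuousAt
  have huc : Continuous u := continuous_iff_continuousAt.2 fun x => (hu x).continuousAt
  simp only [← huw] at h3
  have d1 : deriv u = fun x => 2 * u x - w x := funext fun x => (hu x).deriv
  have d2 : deriv (deriv u) = fun x => 2 * (2 * u x - w x) - wx x := by
    rw [d1]
    exact funext fun x => (((hu x).const_mul 2).sub (hw x)).deriv
  have n1 := eLpNorm_two_mul_sub_le hp (hθ.mul huc) (hθ.mul hwc) h3 h1
  have n2 := eLpNorm_two_mul_sub_le hp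
    ((continuous_const.mul (hθ.mul huc)).sub (hθ.mul hwc)) (hθ.mul hwx) n1 h2
  rw [weightedNorm, d2, d1]
  -- The norms of u, u_x = 2u - w and u_xx = 2u_x - w_x cost B, 3B and 7B.
  calc _ ≤ B + (2 * B + B) + (2 * (2 * B + B) + B) := by
        refine add_le_add (add_le_add ?_ ?_) ?_
        · simpa only [mul_comm] using h3
        · refine le_trans (le_of_eq ?_) n1
          congr 1; ext x; simp only [Pi.mul_apply]; ring
        · refine le_trans (le_of_eq ?_) n2
          congr 1; ext x; simp only [Pi.mul_apply, Pi.sub_apply]; ring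
    _ = 11 * B := by ring

lemma WeightedBound.mono {p B B' : ℝ≥0∞} (hB : B ≤ B') {θ w wx : ℝ → ℝ}
    (h : WeightedBound p B θ w wx) : WeightedBound p B' θ w wx :=
  ⟨h.1.trans hB, h.2.1.trans hB, h.2.2.trans hB⟩

namespace IsReducedSolution
variable {T M : ℝ} {w wx : ℝ → ℝ → ℝ}

lemma exists_weightedBound_of_convGreen (h : IsReducedSolution T M w wx) {p : ℝ≥0∞} (hp : 1 ≤ p)
    {a : ℝ} (ha : 0 ≤ a) {θ k : ℝ → ℝ} (hθ : IsLogLipschitz a θ)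
    (hk : AEMeasurable k) (hk0 : ∀ x, 0 ≤ k x) (hkI : ∫⁻ z, ENNReal.ofReal (k z) ≠ ⊤)
    (hkθ : ∀ x z, θ x * Real.exp (-2 * |z|) ≤ k z * θ (x + z)) {m : ℝ≥0∞} (hm' : m ≠ ⊤)
    (hm : ∀ τ ∈ Icc 0 T, eLpNorm (fun x => θ x * convGreen (fun y => w τ y ^ 2) x) p volume ≤ m)
    (h0 : eLpNorm (fun x => θ x * w 0 x) p volume ≠ ⊤)
    (h0x : eLpNorm (fun x => θ x * wx 0 x) p volume ≠ ⊤) :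
    ∃ B : ℝ≥0∞, B ≠ ⊤ ∧ ∀ t ∈ Icc 0 T, WeightedBound p B θ (w t) (wx t) := by
  obtain ⟨B, hB, hBt⟩ := h.exists_eLpNorm_bound hp ha hθ hm' hm h0 h0x
  refine ⟨max B ((∫⁻ z, ENNReal.ofReal (k z)) * B), by finiteness, fun t ht => ?_⟩
  obtain ⟨h1, h2⟩ := hBt t ht
  refine ⟨h1.trans (le_max_left _ _), h2.trans (le_max_left _ _), le_trans ?_ (le_max_right _ _)⟩
  exact (eLpNorm_mul_halfLineIntegral_le hp hθ.cont hθ.nonneg (h.continuous_slice t) hk hk0 hkI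
    hkθ).trans (mul_le_mul_right h1 _)

theorem exists_weightedBound (h : IsReducedSolution T M w wx) {p : ℝ≥0∞} (hp : 1 ≤ p)
    {v φ : ℝ → ℝ} (hφ : IsFastGrowingWeight p v φ)
    (h0 : eLpNorm (fun x => φ x * w 0 x) p volume ≠ ⊤)
    (h0x : eLpNorm (fun x => φ x * wx 0 x) p volume ≠ ⊤)
    (h2 : eLpNorm (fun x => √(φ x) * w 0 x) 2 volume ≠ ⊤)
    (h2x : eLpNorm (fun x => √(φ x) * wx 0 x) 2 volume ≠ ⊤) :
    ∃ B : ℝ≥0∞, B ≠ ⊤ ∧ ∀ t ∈ Icc 0 T, WeightedBound p B φ (w t) (wx t) ∧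
      WeightedBound 2 B (fun x => √(φ x)) (w t) (wx t) := by
  obtain ⟨A, hA, hlog⟩ := hφ.exists_isLogLipschitz
  have hA0 : 0 ≤ A := by linarith
  obtain ⟨C, hC, hCφ⟩ := hφ.moderate.moderate
  have hv := hφ.weight.nonneg
  have hpos := hφ.moderate.pos
  have hI := integrable_weightKernel (C := C) hp hφ.memLp
  set k := weightKernel C v with hk
  have hkm : AEMeasurable k := hI.aestronglyMeasurable.aemeasurable
  have hkI : ∫⁻ z, ENNReal.ofReal (k z) ≠ ⊤ := hI.lintegral_lt_top.ne
  have hk1 := exp_le_weightKernel hC.le hv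
  have hk0 : ∀ z, 0 ≤ k z := fun z => (Real.exp_pos _).le.trans (hk1 z)
  -- Moderateness with shift -z; this is why the kernel contains v(-z).
  have hmod : ∀ x z, φ x ≤ C * v (-z) * φ (x + z) := fun x z => by
    have := hCφ (-z) (x + z)
    rwa [neg_add_cancel_comm_assoc] at this
  have hkφ : ∀ x z, φ x * Real.exp (-2 * |z|) ≤ k z * φ (x + z) := fun x z => by
    calc φ x * Real.exp (-2 * |z|) ≤ C * v (-z) * φ (x + z) * Real.exp (-2 * |z|) :=
          mul_le_mul_of_nonneg_right (hmod x z) (Real.exp_pos _).le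
      _ = C * v (-z) * Real.exp (-2 * |z|) * φ (x + z) := by ring
      _ ≤ k z * φ (x + z) :=
          mul_le_mul_of_nonneg_right (mul_exp_le_weightKernel hC.le hv z) (hpos _).le
  have hlog2 := hlog.sqrt hA0
  have hksqrt : ∀ x z, √(φ x) * Real.exp (-|z|) ≤ k z * √(φ (x + z)) := fun x z => by
    calc √(φ x) * Real.exp (-|z|) ≤ √(C * v (-z) * φ (x + z)) * Real.exp (-|z|) :=
          mul_le_mul_of_nonneg_right (Real.sqrt_le_sqrt (hmod x z)) (Real.exp_pos _).le
      _ = √(C * v (-z)) * Real.exp (-|z|) * √(φ (x + z)) := by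
          rw [Real.sqrt_mul (mul_nonneg hC.le (hv _))]; ring
      _ ≤ k z * √(φ (x + z)) :=
          mul_le_mul_of_nonneg_right (sqrt_mul_exp_le_weightKernel hC.le hv z) (Real.sqrt_nonneg _)
  have hksqrt' : ∀ x z, √(φ x) * Real.exp (-2 * |z|) ≤ k z * √(φ (x + z)) := fun x z =>
    (mul_le_mul_of_nonneg_left (Real.exp_le_exp.2 (by linarith [abs_nonneg z]))
      (Real.sqrt_nonneg _)).trans (hksqrt x z)
  -- First stage: the L² bound with weight √φ, on which the L^p bound depends.
  obtain ⟨D, hD, hDt⟩ := h.exists_eLpNorm_two_mul_le (by linarith : 1 / 4 ≤ A) hkm hk1 hkI hlog2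
    hksqrt
  set E := D * eLpNorm (fun x => √(φ x) * w 0 x) 2 volume with hE
  have hE' : E ≠ ⊤ := ENNReal.mul_ne_top hD h2
  obtain ⟨B₂, hB₂, hBt₂⟩ := h.exists_weightedBound_of_convGreen one_le_two hA0 hlog2 hkm hk0 hkI
    hksqrt' (m := ENNReal.ofReal M * ((∫⁻ z, ENNReal.ofReal (k z)) * E)) (by finiteness)
    (fun τ hτ => (eLpNorm_mul_convGreen_sq_le one_le_two hlog2.cont hlog2.nonneg
      (h.continuous_slice τ) (h.bound τ) hkm hk0 hkI hksqrt).trans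
      (mul_le_mul_right (mul_le_mul_right (hDt τ hτ) _) _)) h2 h2x
  -- Second stage: φ w² is now bounded in L¹ by E², and v e^{-|x|} itself serves as the L^p kernel.
  have hvm := hφ.memLp
  have hkey : ∀ τ ∈ Icc 0 T, eLpNorm (fun x => φ x * convGreen (fun y => w τ y ^ 2) x) p volume ≤
      eLpNorm (fun x => C * (v x * Real.exp (-|x|))) p volume * E ^ 2 := fun τ hτ => by
    refine (eLpNorm_mul_convGreen_sq_le' hp hlog.cont hlog.nonneg (h.continuous_slice τ)
      (h.bound τ) (k := fun x => C * (v x * Real.exp (-|x|)))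
      (hvm.const_mul C).aestronglyMeasurable.aemeasurable
      (fun x => mul_nonneg hC.le (mul_nonneg (hv x) (Real.exp_pos _).le)) (fun x y => ?_)
      (ne_top_of_le_ne_top hE' (hDt τ hτ))).trans ?_
    · have := hCφ (x - y) y
      rw [sub_add_cancel] at this
      calc φ x * Real.exp (-|x - y|) ≤ C * v (x - y) * φ y * Real.exp (-|x - y|) :=
            mul_le_mul_of_nonneg_right this (Real.exp_pos _).le
        _ = _ := by ring
    · gcongr
      exact hDt τ hτ
  have hfin := (hvm.const_mul C).eLpNorm_ne_top
  obtain ⟨B₁, hB₁, hBt₁⟩ := h.exists_weightedBound_of_convGreen hp hA0 hlog hkm hk0 hkI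
    hkφ (by finiteness) hkey h0 h0x
  exact ⟨max B₁ B₂, by finiteness, fun t ht => ⟨(hBt₁ t ht).mono (le_max_left _ _),
    (hBt₂ t ht).mono (le_max_right _ _)⟩⟩

end IsReducedSolution
end GCH
end

noncomputable section
namespace GCH
open MeasureTheory Set Filter Topology
open scoped ENNReal

/-! ### Strong solutions -/

/-- Both sides are continuous and define the same distribution, so they agree almost everywhere and
hence everywhere. -/
lemma Represents.eq_besselEval {f : ℝ → ℝ} {F : TemperedDistribution ℝ ℂ} (hf : Represents f F)
    {r : ℝ} (hr : 1 / 2 < r) {g : L2} (hF : HasBesselPotential r F g) (x : ℝ) :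
    (f x : ℂ) = besselEval r 0 x g := by
  obtain ⟨hfc, hfm, hfF⟩ := hf
  have hc : Continuous fun x => besselEval r 0 x g := continuous_besselEval (by simpa using hr) g
  have hc' : Continuous fun x => (f x : ℂ) := by fun_prop
  have hR : Continuous fun x => (f x : ℂ) - besselEval r 0 x g := hc'.sub hc
  have h0 : (fun x => (f x : ℂ) - besselEval r 0 x g) =ᵐ[volume] fun _ => 0 := by
    refine ae_eq_zero_of_integral_contDiff_smul_eq_zero hR.locallyIntegrable fun ψ h1 h2 => ?_
    have s0 : HasCompactSupport fun x => (ψ x : ℂ) :=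
      h2.comp_left (g := fun x : ℝ => (x : ℂ)) Complex.ofReal_zero
    have k0 : ContDiff ℝ (⊤ : ℕ∞) fun x => (ψ x : ℂ) := Complex.ofRealCLM.contDiff.comp h1
    have e1 := hF.apply_eq_integral hr (s0.toSchwartzMap k0)
    have e2 : F (s0.toSchwartzMap k0) = ∫ x, (ψ x : ℂ) * f x := by
      rw [hfF, Lp.toTemperedDistribution_apply]
      refine integral_congr_ae ?_
      filter_upwards [hfm.coeFn_toLp] with x hx
      rw [hx]; rfl
    rw [e2] at e1
    simp only [Complex.real_smul, mul_sub]
    rw [integral_sub (integrable_mul_of_hasCompactSupport k0.continuous s0 hc')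
      (integrable_mul_of_hasCompactSupport k0.continuous s0 hc), e1]
    exact sub_self _
  have h1 := Continuous.ae_eq_iff_eq volume hR continuous_const |>.1 h0
  exact sub_eq_zero.1 (congrFun h1 x)

lemma continuous_besselEval_uncurry {r : ℝ} {j : ℕ} (h : j + 1 / 2 < r) {G : ℝ → L2}
    (hG : Continuous G) : Continuous fun z : ℝ × ℝ => besselEval r j z.2 (G z.1) := by
  refine continuous_iff_continuousAt.2 fun z₀ => ?_
  rw [ContinuousAt, tendsto_iff_dist_tendsto_zero]
  set C := (eLpNorm (besselSymbol r j) 2 volume).toReal with hC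
  have h1 : Continuous fun z : ℝ × ℝ => C * ‖G z.1 - G z₀.1‖ +
      ‖besselEval r j z.2 (G z₀.1) - besselEval r j z₀.2 (G z₀.1)‖ := by
    have := continuous_besselEval h (G z₀.1)
    fun_prop
  have h2 := h1.tendsto z₀
  simp only [sub_self, norm_zero, mul_zero, add_zero] at h2
  refine squeeze_zero (fun _ => dist_nonneg) (fun z => ?_) h2
  rw [dist_eq_norm, ← sub_add_sub_cancel _ (besselEval r j z.2 (G z₀.1)), ← map_sub]
  refine (norm_add_le _ _).trans (add_le_add ?_ le_rfl)
  exact ((besselEval r j z.2).le_opNorm _).trans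
    (mul_le_mul_of_nonneg_right (norm_besselEval_le h _) (norm_nonneg _))

lemma norm_besselEval_apply_le {r : ℝ} {j : ℕ} (h : j + 1 / 2 < r) (x : ℝ) (g : L2) :
    ‖besselEval r j x g‖ ≤ (eLpNorm (besselSymbol r j) 2 volume).toReal * ‖g‖ :=
  ((besselEval r j x).le_opNorm _).trans
    (mul_le_mul_of_nonneg_right (norm_besselEval_le h _) (norm_nonneg _))

lemma hasDerivAt_re {G : ℝ → ℂ} {G' : ℂ} {x : ℝ} (hG : HasDerivAt G G' x) :
    HasDerivAt (fun x => (G x).re) G'.re x :=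
  (Complex.reCLM.hasFDerivAt.comp_hasDerivAt x hG :)

theorem IsStrongSolution.exists_isReducedSolution {s T : ℝ} {u₀ : ℝ → ℝ} {u : ℝ → ℝ → ℝ}
    (hs : 5 / 2 < s) (hT : 0 < T) (h : IsStrongSolution s T u₀ u) :
    ∃ (M : ℝ) (w wx : ℝ → ℝ → ℝ), IsReducedSolution T M w wx ∧
      ∀ t ∈ Icc 0 T, (∀ x, HasDerivAt (u t) (2 * u t x - w t x) x) ∧
        ∀ x, u t x = halfLineIntegral 2 (w t) x := by
  obtain ⟨-, U, hU, ⟨g, hg, hgc⟩, hV⟩ := h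
  have s0 : ((0 : ℕ) : ℝ) + 1 / 2 < s := by push_cast; linarith
  have s1 : ((1 : ℕ) : ℝ) + 1 / 2 < s := by push_cast; linarith
  have s2 : ((2 : ℕ) : ℝ) + 1 / 2 < s := by push_cast; linarith
  have r0 : ((0 : ℕ) : ℝ) + 1 / 2 < s - 1 := by push_cast; linarith
  have r1 : ((1 : ℕ) : ℝ) + 1 / 2 < s - 1 := by push_cast; linarith
  -- The curve is frozen outside [0, T], which gives global continuity and bounds in time without
  -- affecting the equation on (0, T).
  set G : ℝ → L2 := fun t => g (projIcc 0 T hT.le t) with hG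
  have hGc : Continuous G := hgc.domRestrict.comp continuous_projIcc
  have hGg : ∀ t ∈ Icc 0 T, G t = g t := fun t ht => by simp only [hG, projIcc_of_mem hT.le ht]
  obtain ⟨R, hR⟩ : ∃ R, ∀ t, ‖G t‖ ≤ R := by
    obtain ⟨R, hR⟩ := isCompact_Icc.exists_bound_of_continuousOn hgc
    exact ⟨R, fun t => hR _ (projIcc 0 T hT.le t).2⟩
  have hR0 : 0 ≤ R := (norm_nonneg _).trans (hR 0)
  set a : ℕ → ℝ → ℝ → ℝ := fun j t x => (besselEval s j x (G t)).re with ha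
  have hac : ∀ j : ℕ, (j : ℝ) + 1 / 2 < s → Continuous fun z : ℝ × ℝ => a j z.1 z.2 := fun j hj =>
    Complex.continuous_re.comp (continuous_besselEval_uncurry hj hGc)
  set C : ℕ → ℝ := fun j => (eLpNorm (besselSymbol s j) 2 volume).toReal with hC
  have hC0 : ∀ j, 0 ≤ C j := fun j => ENNReal.toReal_nonneg
  have hab : ∀ j : ℕ, (j : ℝ) + 1 / 2 < s → ∀ t x, |a j t x| ≤ C j * R := fun j hj t x =>
    (Complex.abs_re_le_norm _).trans ((norm_besselEval_apply_le hj x (G t)).trans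
      (mul_le_mul_of_nonneg_left (hR t) (hC0 j)))
  have had : ∀ j : ℕ, (j : ℝ) + 1 + 1 / 2 < s → ∀ t x, HasDerivAt (a j t) (a (j + 1) t x) x :=
    fun j hj t x => hasDerivAt_re (hasDerivAt_besselEval hj (G t) x)
  have hua : ∀ t ∈ Icc 0 T, u t = a 0 t := fun t ht => funext fun x => by
    have := (hU t ht).eq_besselEval (by linarith) (hg t ht) x
    simp only [ha, hGg t ht, ← this, Complex.ofReal_re]
  have d0 := had 0 (by push_cast; linarith)
  have d1 := had 1 (by push_cast; linarith)
  have b0 := hab 0 s0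
  have b1 := hab 1 s1
  have b2 := hab 2 s2
  have c0 := hac 0 s0
  have c1 := hac 1 s1
  have c2 := hac 2 s2
  have p0 := mul_nonneg (hC0 0) hR0
  have p1 := mul_nonneg (hC0 1) hR0
  have p2 := mul_nonneg (hC0 2) hR0
  set M : ℝ := 2 * (C 0 * R) + 2 * (C 1 * R) + C 2 * R with hM
  have hM0 : 0 ≤ M := by positivity
  set w : ℝ → ℝ → ℝ := fun t x => 2 * a 0 t x - a 1 t x with hw
  set wx : ℝ → ℝ → ℝ := fun t x => 2 * a 1 t x - a 2 t x with hwx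
  have hwd : ∀ t x, HasDerivAt (w t) (wx t x) x := fun t x =>
    ((d0 t x).const_mul 2).sub (d1 t x)
  have hwb : ∀ t x, |w t x| ≤ M := fun t x => by
    have h1 := abs_le.1 (b0 t x)
    have h2 := abs_le.1 (b1 t x)
    rw [abs_le]; constructor <;> simp only [hw, hM] <;> linarith
  have hwxb : ∀ t x, |wx t x| ≤ M := fun t x => by
    have h1 := abs_le.1 (b1 t x)
    have h2 := abs_le.1 (b2 t x)
    rw [abs_le]; constructor <;> simp only [hwx, hM] <;> linarith
  have hwc : Continuous fun z : ℝ × ℝ => w z.1 z.2 := (c0.const_mul 2).sub c1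
  have hwxc : Continuous fun z : ℝ × ℝ => wx z.1 z.2 := (c1.const_mul 2).sub c2
  have hslice : ∀ t, Continuous (w t) := fun t =>
    continuous_iff_continuousAt.2 fun x => (hwd t x).continuousAt
  have hslicex : ∀ t, Continuous (wx t) := fun t =>
    hwxc.comp (f := fun x : ℝ => (t, x)) (by fun_prop)
  have key : ∀ t ∈ Ioo 0 T, (∀ x, HasDerivAt (fun τ => w τ x)
      (2 * w t x * wx t x + 3 * convGreenDeriv (fun y => w t y ^ 2) x) t) ∧
      ∀ x, HasDerivAt (convGreenDeriv fun y => w t y ^ 2)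
        (convGreen (fun y => w t y ^ 2) x - w t x ^ 2) x := by
    intro t ht
    have ht' := Ioo_subset_Icc_self ht
    obtain ⟨V, ⟨k, k', hk, hVk, hkd⟩, heq⟩ := hV t ht
    set D : ℕ → ℝ := fun j => (eLpNorm (besselSymbol (s - 1) j) 2 volume).toReal * ‖k'‖ with hD
    have hDb : ∀ j : ℕ, (j : ℝ) + 1 / 2 < s - 1 → ∀ x, ‖besselEval (s - 1) j x k'‖ ≤ D j :=
      fun j hj x => norm_besselEval_apply_le hj x k'
    have hD0 : ∀ j, 0 ≤ D j := fun j => mul_nonneg ENNReal.toReal_nonneg (norm_nonneg _)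
    have hqb : ∀ x, |w t x ^ 2| ≤ M ^ 2 := fun x => by
      rw [abs_pow]; exact pow_le_pow_left₀ (abs_nonneg _) (hwb t x) 2
    have hqb' : ∀ x, |2 * w t x * wx t x| ≤ 2 * M ^ 2 := fun x => by
      rw [abs_mul, abs_mul, abs_two, pow_two, mul_assoc]
      refine mul_le_mul_of_nonneg_left ?_ two_pos.le
      exact mul_le_mul (hwb t x) (hwxb t x) (abs_nonneg _) hM0
    have hM2 : 0 ≤ M ^ 2 := sq_nonneg M
    have hq : ∀ x, w t x ^ 2 = (2 * u t x - deriv (u t) x) ^ 2 := fun x => by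
      simp only [hw, hua t ht', (d0 t x).deriv]
    have hqd : ∀ x, HasDerivAt (fun x => w t x ^ 2) (2 * w t x * wx t x) x := fun x =>
      ((hwd t x).pow 2).congr_deriv (by simp)
    obtain ⟨e1, e2⟩ := heq.eq_convGreenDeriv (V := fun x => besselEval (s - 1) 0 x k')
      (V' := fun x => besselEval (s - 1) 1 x k') (q := fun x => w t x ^ 2)
      (q' := fun x => 2 * w t x * wx t x) (K := D 0 + D 1 + 2 * M ^ 2)
      (hVk.apply_eq_integral (by linarith))
      (fun x => hasDerivAt_besselEval (by push_cast; linarith) k' x)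
      (continuous_besselEval r1 k') hq hqd
      ((continuous_const.mul (hslice t)).mul (hslicex t))
      (fun x => (hDb 0 r0 x).trans (by linarith [hD0 1]))
      (fun x => (hDb 1 r1 x).trans (by linarith [hD0 0]))
      (fun x => (hqb x).trans (by linarith [hD0 0, hD0 1]))
      (fun x => (hqb' x).trans (by linarith [hD0 0, hD0 1]))
    refine ⟨fun x => ?_, e2⟩
    rw [← e1]
    have f1 : HasDerivAt (fun τ => 2 * (besselEval (s - 1) 0 x (k τ)).re -
        (besselEval (s - 1) 1 x (k τ)).re)
        (2 * (besselEval (s - 1) 0 x k').re - (besselEval (s - 1) 1 x k').re) t := by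
      -- Evaluation of a function or its derivative at x is a bounded functional on H^{s-1}, so it
      -- commutes with the time derivative.
      have g0 := fun j : ℕ => hasDerivAt_re
        (((besselEval (s - 1) j x).restrictScalars ℝ).hasFDerivAt.comp_hasDerivAt t hkd)
      exact ((g0 0).const_mul 2).sub (g0 1)
    refine f1.congr_of_eventuallyEq ?_
    filter_upwards [hk, Ioo_mem_nhds ht.1 ht.2] with τ hτ hτ'
    have hτI := Ioo_subset_Icc_self hτ'
    -- The H^s and H^{s-1} descriptions of u(τ) have the same continuous representative, hence also
    -- the same x-derivative.
    have q0 : ∀ y, a 0 τ y = (besselEval (s - 1) 0 y (k τ)).re := fun y => by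
      have := (hU τ hτI).eq_besselEval (by linarith) hτ y
      rw [← this, Complex.ofReal_re, hua τ hτI]
    have q1 : a 1 τ x = (besselEval (s - 1) 1 x (k τ)).re := by
      have m1 := d0 τ x
      rw [funext q0] at m1
      exact m1.unique (hasDerivAt_re
        (hasDerivAt_besselEval (r := s - 1) (by push_cast; linarith) (k τ) x))
    simp only [hw, q0, q1]
  refine ⟨M, w, wx, ⟨hT, hwc, hwxc, hwb, hwxb, hwd, fun t ht => (key t ht).1,
    fun t ht => (key t ht).2⟩, fun t ht => ?_⟩
  have hud : ∀ x, HasDerivAt (u t) (2 * u t x - w t x) x := fun x => by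
    rw [hua t ht]
    exact (d0 t x).congr_deriv (by simp only [hw]; ring)
  refine ⟨hud, fun x => ?_⟩
  refine eq_halfLineIntegral two_pos (hslice t) (hwb t) (K := C 0 * R) (fun x => ?_) hud x
  rw [hua t ht]; exact b0 t x

lemma MemWeighted.eLpNorm_ne_top {p : ℝ≥0∞} {θ u w wx : ℝ → ℝ} (h : MemWeighted p θ u)
    (hu : ∀ x, HasDerivAt u (2 * u x - w x) x) (hw : ∀ x, HasDerivAt w (wx x) x) :
    eLpNorm (fun x => θ x * w x) p volume ≠ ⊤ ∧ eLpNorm (fun x => θ x * wx x) p volume ≠ ⊤ := by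
  have d1 : deriv u = fun x => 2 * u x - w x := funext fun x => (hu x).deriv
  have d2 : deriv (deriv u) = fun x => 2 * (2 * u x - w x) - wx x := by
    rw [d1]
    exact funext fun x => (((hu x).const_mul 2).sub (hw x)).deriv
  obtain ⟨h0, h1, h2⟩ := h
  rw [d2] at h2
  rw [d1] at h1
  constructor
  · convert ((h0.const_mul 2).sub h1).eLpNorm_ne_top using 2
    ext x; simp only [Pi.sub_apply]; ring
  · convert ((h1.const_mul 2).sub h2).eLpNorm_ne_top using 2
    ext x; simp only [Pi.sub_apply]; ring

lemma isFastGrowingWeight_exp_abs :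
    IsFastGrowingWeight ⊤ (fun x => Real.exp |x|) (fun x => Real.exp |x|) where
  locallyAbsolutelyContinuous a b := by
    obtain ⟨K, hK⟩ := (Real.contDiff_exp (n := 1)).contDiffOn.exists_lipschitzOnWith
      (s := Icc 0 (|a| + |b|)) one_ne_zero (convex_Icc _ _) isCompact_Icc
    have h1 : LipschitzOnWith 1 (fun x : ℝ => |x|) (uIcc a b) :=
      (LipschitzWith.of_dist_le_mul fun x y => by
        simpa [Real.dist_eq] using abs_abs_sub_abs_le_abs_sub x y).lipschitzOnWith
    refine (hK.comp h1 fun x hx => ⟨abs_nonneg x, ?_⟩).absolutelyContinuousOnInterval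
    have h2 := abs_le.1 (le_refl |a|)
    have h3 := abs_le.1 (le_refl |b|)
    rw [abs_le]
    rcases mem_uIcc.1 hx with h | h <;> constructor <;>
      linarith [h.1, h.2, abs_nonneg a, abs_nonneg b]
  weight := ⟨fun x => (Real.exp_pos _).le, fun x y => by
    rw [← Real.exp_add]; exact Real.exp_le_exp.2 (abs_add_le x y)⟩
  moderate := ⟨fun x => Real.exp_pos _, 1, one_pos, fun x y => by
    rw [one_mul, ← Real.exp_add]; exact Real.exp_le_exp.2 (abs_add_le x y)⟩
  iInf_pos := one_pos.trans_le (le_ciInf fun x => Real.one_le_exp (abs_nonneg x))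
  memLp := by
    -- Here v e^{-|x|} is identically 1: bounded, but not integrable.
    simp only [← Real.exp_add, add_neg_cancel, Real.exp_zero]
    exact memLp_top_const 1
  deriv_le := by
    refine ⟨1, one_pos, ?_⟩
    have : ∀ᵐ x : ℝ, x ≠ 0 := by simp [ae_iff]
    filter_upwards [this] with x hx
    rw [(hasDerivAt_abs hx).exp.deriv, abs_mul, one_mul]
    refine mul_le_of_le_one_right (abs_nonneg _) ?_
    rcases hx.lt_or_gt with h | h <;> simp [h]

end GCH
end

theorem theorem3p2 :
    (∀ (p : ENNReal) (v φ : ℝ → ℝ) (s T : ℝ) (u₀ : ℝ → ℝ) (u : ℝ → ℝ → ℝ),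
      2 ≤ p →
      GCH.IsFastGrowingWeight p v φ →
      5 / 2 < s →
      0 < T →
      GCH.MemWeighted p φ u₀ →
      GCH.MemWeighted 2 (fun x => φ x ^ (1 / 2 : ℝ)) u₀ →
      GCH.IsStrongSolution s T u₀ u →
      (⨆ t ∈ Set.Icc 0 T, GCH.weightedNorm p φ (u t)) < ⊤ ∧
      (⨆ t ∈ Set.Icc 0 T, GCH.weightedNorm 2 (fun x => φ x ^ (1 / 2 : ℝ)) (u t)) < ⊤) ∧
    GCH.IsFastGrowingWeight ⊤ (fun x => Real.exp |x|) (fun x => Real.exp |x|) := by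
  refine ⟨fun p v φ s T u₀ u hp hφ hs hT h₀ h₀' hu => ?_, GCH.isFastGrowingWeight_exp_abs⟩
  have hp1 : 1 ≤ p := one_le_two.trans hp
  have hu0 := hu.1
  obtain ⟨M, w, wx, hw, huw⟩ := hu.exists_isReducedSolution hs hT
  simp only [← Real.sqrt_eq_rpow] at h₀' ⊢
  have hi := (huw 0 ⟨le_rfl, hT.le⟩).1
  rw [hu0] at hi
  obtain ⟨i1, i2⟩ := h₀.eLpNorm_ne_top hi (hw.hasDerivAt_x 0)
  obtain ⟨i3, i4⟩ := h₀'.eLpNorm_ne_top hi (hw.hasDerivAt_x 0)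
  obtain ⟨B, hB, hBt⟩ := hw.exists_weightedBound hp1 hφ i1 i2 i3 i4
  have hφc := hφ.locallyAbsolutelyContinuous.continuous
  have hfin : 11 * B < ⊤ := by finiteness
  refine ⟨lt_of_le_of_lt (iSup₂_le fun t ht => ?_) hfin,
    lt_of_le_of_lt (iSup₂_le fun t ht => ?_) hfin⟩
  · exact (hBt t ht).1.weightedNorm_le hp1 hφc (hw.continuous_slice_x t) (hw.hasDerivAt_x t)
      (huw t ht).1 (huw t ht).2
  · exact (hBt t ht).2.weightedNorm_le one_le_two hφc.sqrt (hw.continuous_slice_x t)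
      (hw.hasDerivAt_x t) (huw t ht).1 (huw t ht).2
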